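/- Let $\varphi:\mathbb{R}\to\mathbb{R}$ be the saturation function, $\varphi(x)=-1$ for $x<-1$, $\varphi(x)=x$ for $-1\le x\le 1$, $\varphi(x)=1$ for $x>1$. For real $k_1,k_2$ with $k_2\neq 0$ and for $\varepsilon>0$ consider the system \[ \begin{aligned} \dot x_1&=x_2-x_1(x_1^2+x_2^2-1),\\ \dot x_2&=-x_1-x_2(x_1^2+x_2^2-1)+\varepsilon\,(\sin t+\varphi(k_1x_3)),\\ \dot x_3&=x_4-x_3(x_3^2+x_4^2-1),\\ \dot x_4&=-x_3-x_4(x_3^2+x_4^2-1)+\varepsilon\,\varphi(k_2x_2), \end{aligned} \] and put $\xi(\theta,\eta)=(\sin\theta,\cos\theta,\sin\eta,\cos\eta)$ for $(\theta,\eta)\in\mathbb{R}^2$. Call a point $p\in\mathbb{R}^4$ a limit point of $2\pi$-periodic solutions if there are $\varepsilon_m>0$ with $\varepsilon_m\to0$ and $2\pi$-periodic solutions $x_m:\mathbb{R}\to\mathbb{R}^4$ of the system with $\varepsilon=\varepsilon_m$ such that $x_m(0)\to p$. (1) If $|k_1|>1$, then no point of $\xi(\mathbb{R}\times\mathbb{R})$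 is a limit point of $2\pi$-periodic solutions. (2) If $|k_1|<1$, then exactly four points $p_1,\dots,p_4$ of $\xi(\mathbb{R}\times\mathbb{R})$ are limit points of $2\pi$-periodic solutions, and there is $\varepsilon_0>0$ such that for every $\varepsilon\in(0,\varepsilon_0]$ the system has four distinct $2\pi$-periodic solutions $x_{1,\varepsilon},\dots,x_{4,\varepsilon}$, with $x_{i,\varepsilon}(0)\to p_i$ as $\varepsilon\to0^+$ for $i=1,\dots,4$. If moreover $|k_1k_2|\neq1$, then these solutions are isolated: there is $\delta>0$ such that for every $\varepsilon\in(0,\varepsilon_0]$ and every $i$ the solution $x_{i,\varepsilon}$ is the only $2\pi$-periodic solution of the system with initial condition in the open ball of radius $\delta$ about $p_i$. -/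

import Mathlib

open Filter Topology

/-- The saturation function: `-1` on `(-∞, -1)`, the identity on `[-1, 1]`, `1` on `(1, ∞)`. -/
noncomputable def saturation (x : ℝ) : ℝ :=
  if x < -1 then -1 else if x ≤ 1 then x else 1

/-- The right-hand side at time `t` of the perturbed pair of planar limit-cycle oscillators.
The coordinates `x₁, x₂, x₃, x₄` are `x 0, x 1, x 2, x 3`. -/
noncomputable def oscillatorField (k₁ k₂ ε t : ℝ) (x : Fin 4 → ℝ) : Fin 4 → ℝ :=
  ![x 1 - x 0 * (x 0 ^ 2 + x 1 ^ 2 - 1),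
    -x 0 - x 1 * (x 0 ^ 2 + x 1 ^ 2 - 1) + ε * (Real.sin t + saturation (k₁ * x 2)),
    x 3 - x 2 * (x 2 ^ 2 + x 3 ^ 2 - 1),
    -x 2 - x 3 * (x 2 ^ 2 + x 3 ^ 2 - 1) + ε * saturation (k₂ * x 1)]

/-- `x` is a `2π`-periodic solution, defined on all of `ℝ`, of the system with parameter `ε`. -/
def IsPeriodicSolution (k₁ k₂ ε : ℝ) (x : ℝ → Fin 4 → ℝ) : Prop :=
  (∀ t, HasDerivAt x (oscillatorField k₁ k₂ ε t (x t)) t) ∧ Function.Periodic x (2 * Real.pi)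

/-- The initial conditions `ξ(θ, η)` of the `2π`-periodic orbits of the unperturbed system. -/
noncomputable def torusPoint (θ η : ℝ) : Fin 4 → ℝ :=
  ![Real.sin θ, Real.cos θ, Real.sin η, Real.cos η]

/-- Some `2π`-periodic solutions of the systems with parameters `ε m > 0`, `ε m → 0`, have
initial conditions converging to `p`. -/
def IsLimitOfPeriodicSolutions (k₁ k₂ : ℝ) (p : Fin 4 → ℝ) : Prop :=
  ∃ (ε : ℕ → ℝ) (x : ℕ → ℝ → Fin 4 → ℝ),
    (∀ m, 0 < ε m) ∧ Tendsto ε atTop (𝓝 0) ∧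
    (∀ m, IsPeriodicSolution k₁ k₂ (ε m) (x m)) ∧
    Tendsto (fun m => x m 0) atTop (𝓝 p)

/-!
In the complex variables `x₂ + i x₁ = exp (U + i s)`, `x₄ + i x₃ = exp (V + i (s + d))`, with the
shifted time `s = t + c`, the system becomes
`U' = 1 - exp (2 Re U) + ε A`, `V' = 1 - exp (2 Re V) + ε B`, where `A` and `B` are the forcings
divided by the oscillator variables (`driveA`, `driveB`). The amplitudes `Re U`, `Re V` are strongly
damped, the phases `Im U`, `Im V` move at speed `O(ε)`, and the point of the torus under
consideration is given by `c = θ` and `d = η - θ`.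

*Necessary condition.* A periodic solution starting near the torus stays near it: a maximum
principle bounds it, Gronwall's inequality compares it with the unperturbed motion, and its logarithm
gives small periodic `U`, `V` (`IsPeriodicSolution.exists_isPhaseSolution`). Integrating the phase
equations over a period shows that `Im A` and `Im B` have mean zero, so in the limit these means
vanish at `U = V = 0`. The second one is a nonzero multiple of `sin d`; the first one is then
`-(cos c / 2 + cos d * G)`, with `G` the first harmonic of `φ (k₁ sin)`. As `|G| > 1/2` for
`|k₁| > 1` and `G = k₁ / 2` for `|k₁| ≤ 1`, there is no zero in the first case and there are four in
the interior of the second.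

*Existence and local uniqueness.* Normalize `Im U` and `Im V` to have mean zero by moving their means
into `c` and `d`. The shift of time by `c` has the effect that `φ (k₂ x₂)` depends on `U` only, so the
unknown phases enter through trigonometric functions and the saturation never has to be
differentiated: its Lipschitz continuity is enough. For `|k₁| < 1` the term `φ (k₁ x₃)` is linear
near the torus, the two solvability conditions are trigonometric equations in `c`, `d` with
coefficients that are Lipschitz functionals of `(U, V)`, and they are solved explicitly
(`exists_phase_functional`). With `c` and `d` so eliminated, the equations say that `(U, V)` is a fixed
point of the periodic solution operator of their linear part applied to the remainder. That operator
loses nothing on the amplitudes, where the remainder is quadratically small, and on the phases the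
remainder carries a factor `ε`; so for small `ε` it is a contraction of a small ball of periodic
functions (`exists_unique_normalized_isPhaseSolution`). Its unique fixed point gives the branch of
solutions at each of the four zeros, and the uniqueness of nearby periodic solutions.
-/

/-! ### The saturation and the forcing in logarithmic coordinates -/

theorem saturation_eq_max_min (x : ℝ) : saturation x = max (-1) (min x 1) := by
  unfold saturation
  split_ifs with h1 h2
  · rw [max_eq_left]; exact (min_le_left _ _).trans h1.le
  · rw [min_eq_left h2, max_eq_right (not_lt.mp h1)]
  · rw [min_eq_right (not_le.mp h2).le, max_eq_right (by norm_num)]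

theorem abs_saturation_le_one (x : ℝ) : |saturation x| ≤ 1 := by
  rw [saturation_eq_max_min, abs_le]
  exact ⟨le_max_left _ _, max_le (by norm_num) (min_le_right _ _)⟩

theorem abs_saturation_sub_le (x y : ℝ) : |saturation x - saturation y| ≤ |x - y| := by
  rw [saturation_eq_max_min, saturation_eq_max_min, max_comm (-1), max_comm (-1)]
  exact (abs_max_sub_max_le_abs _ _ _).trans
    ((abs_min_sub_min_le_max _ _ _ _).trans (by simp))

theorem continuous_saturation : Continuous saturation := by
  have : saturation = fun x => max (-1) (min x 1) := funext saturation_eq_max_min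
  rw [this]; fun_prop

theorem saturation_of_abs_le {x : ℝ} (h : |x| ≤ 1) : saturation x = x := by
  rw [saturation_eq_max_min, min_eq_left (abs_le.mp h).2, max_eq_right (abs_le.mp h).1]

theorem saturation_neg (x : ℝ) : saturation (-x) = -saturation x := by
  unfold saturation
  split_ifs <;> linarith

theorem Complex.norm_exp_sub_exp_le {z w : ℂ} (hz : z.re ≤ 1) (hw : w.re ≤ 1) :
    ‖Complex.exp z - Complex.exp w‖ ≤ 3 * ‖z - w‖ := by
  refine Convex.norm_image_sub_le_of_norm_deriv_le (s := {z : ℂ | z.re ≤ 1}) (𝕜 := ℂ)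
    (fun x _ => Complex.differentiableAt_exp) (fun x hx => ?_) (convex_halfSpace_re_le 1) hw hz
  rw [Complex.deriv_exp, Complex.norm_exp]
  exact (Real.exp_le_exp.mpr hx).trans (Real.exp_one_lt_three.le)

theorem Complex.norm_exp_le_three {z : ℂ} (hz : z.re ≤ 1) : ‖Complex.exp z‖ ≤ 3 := by
  rw [Complex.norm_exp]
  exact (Real.exp_le_exp.mpr hz).trans (Real.exp_one_lt_three.le)

/-- The forcing of the first oscillator in logarithmic coordinates. With `s = t + c`,
`x₂ + i x₁ = exp (z + i s)` and `x₄ + i x₃ = exp (w + i (s + d))`, it is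
`(sin t + φ (k₁ x₃)) / (x₂ + i x₁)`. -/
noncomputable def driveA (k₁ c d s : ℝ) (z w : ℂ) : ℂ :=
  Complex.exp (-z - s * Complex.I) *
    ((Real.sin (s - c) +
      saturation (k₁ * (Complex.exp (w + (s + d : ℝ) * Complex.I)).im) : ℝ) : ℂ)

/-- The forcing `φ (k₂ x₂) / (x₄ + i x₃)` of the second oscillator in the coordinates of
`driveA`. -/
noncomputable def driveB (k₂ d s : ℝ) (z w : ℂ) : ℂ :=
  Complex.exp (-w - (s + d : ℝ) * Complex.I) *
    (saturation (k₂ * (Complex.exp (z + s * Complex.I)).re) : ℂ)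

theorem norm_driveA_le (k₁ c d s : ℝ) {z : ℂ} (w : ℂ) (hz : ‖z‖ ≤ 1) :
    ‖driveA k₁ c d s z w‖ ≤ 6 := by
  have h := (abs_le.mp ((Complex.abs_re_le_norm z).trans hz)).1
  have h1 : ‖Complex.exp (-z - s * Complex.I)‖ ≤ 3 :=
    Complex.norm_exp_le_three (by simp; linarith)
  have h2 := abs_add_le (Real.sin (s - c))
    (saturation (k₁ * (Complex.exp (w + (s + d : ℝ) * Complex.I)).im))
  have h3 := Real.abs_sin_le_one (s - c)
  have h4 := abs_saturation_le_one (k₁ * (Complex.exp (w + (s + d : ℝ) * Complex.I)).im)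
  rw [driveA, norm_mul, Complex.norm_real, Real.norm_eq_abs]
  calc _ ≤ 3 * 2 := mul_le_mul h1 (by linarith) (abs_nonneg _) (by norm_num)
    _ = 6 := by norm_num

theorem norm_driveB_le (k₂ d s : ℝ) (z : ℂ) {w : ℂ} (hw : ‖w‖ ≤ 1) :
    ‖driveB k₂ d s z w‖ ≤ 6 := by
  have h := (abs_le.mp ((Complex.abs_re_le_norm w).trans hw)).1
  have h1 : ‖Complex.exp (-w - (s + d : ℝ) * Complex.I)‖ ≤ 3 :=
    Complex.norm_exp_le_three (by simp; linarith)
  have h4 := abs_saturation_le_one (k₂ * (Complex.exp (z + s * Complex.I)).re)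
  rw [driveB, norm_mul, Complex.norm_real, Real.norm_eq_abs]
  calc _ ≤ 3 * 2 := mul_le_mul h1 (by linarith) (abs_nonneg _) (by norm_num)
    _ = 6 := by norm_num

theorem norm_mul_ofReal_sub_le {X X' : ℂ} {y y' B Y m n : ℝ} (hX' : ‖X'‖ ≤ B) (hy : |y| ≤ Y)
    (hX : ‖X - X'‖ ≤ m) (hyy : |y - y'| ≤ n) :
    ‖X * (y : ℂ) - X' * (y' : ℂ)‖ ≤ m * Y + B * n := by
  have : X * (y : ℂ) - X' * (y' : ℂ) = (X - X') * (y : ℂ) + X' * ((y - y' : ℝ) : ℂ) := by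
    push_cast; ring
  rw [this]
  refine (norm_add_le _ _).trans (add_le_add ?_ ?_)
  · rw [norm_mul, Complex.norm_real, Real.norm_eq_abs]
    exact mul_le_mul hX hy (abs_nonneg _) ((norm_nonneg _).trans hX)
  · rw [norm_mul, Complex.norm_real, Real.norm_eq_abs]
    exact mul_le_mul hX' hyy (abs_nonneg _) ((norm_nonneg _).trans hX')

theorem norm_exp_add_mul_I_sub_le {z z' : ℂ} (s s' : ℝ) (hz : ‖z‖ ≤ 1) (hz' : ‖z'‖ ≤ 1) :
    ‖Complex.exp (z + s * Complex.I) - Complex.exp (z' + s' * Complex.I)‖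
      ≤ 3 * (‖z - z'‖ + |s - s'|) := by
  have h := (abs_le.mp ((Complex.abs_re_le_norm z).trans hz)).2
  have h' := (abs_le.mp ((Complex.abs_re_le_norm z').trans hz')).2
  refine (Complex.norm_exp_sub_exp_le (by simpa using h) (by simpa using h')).trans ?_
  gcongr
  have : z + s * Complex.I - (z' + s' * Complex.I) = (z - z') + ((s - s' : ℝ) : ℂ) * Complex.I := by
    push_cast; ring
  rw [this]
  refine (norm_add_le _ _).trans ?_
  rw [norm_mul, Complex.norm_I, mul_one, Complex.norm_real, Real.norm_eq_abs]

theorem norm_exp_neg_sub_mul_I_sub_le {z z' : ℂ} (s s' : ℝ) (hz : ‖z‖ ≤ 1) (hz' : ‖z'‖ ≤ 1) :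
    ‖Complex.exp (-z - s * Complex.I) - Complex.exp (-z' - s' * Complex.I)‖
      ≤ 3 * (‖z - z'‖ + |s - s'|) := by
  have := norm_exp_add_mul_I_sub_le (z := -z) (z' := -z') (-s) (-s') (by simpa) (by simpa)
  rw [show -z - -z' = -(z - z') by ring, show -s - -s' = -(s - s') by ring, norm_neg, abs_neg]
    at this
  simpa [sub_eq_add_neg] using this

theorem abs_saturation_mul_im_sub_le (k : ℝ) {z z' : ℂ} {m : ℝ} (h : ‖z - z'‖ ≤ m) :
    |saturation (k * z.im) - saturation (k * z'.im)| ≤ |k| * m := by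
  refine (abs_saturation_sub_le _ _).trans ?_
  rw [← mul_sub, abs_mul, ← Complex.sub_im]
  gcongr
  exact (Complex.abs_im_le_norm _).trans h

theorem abs_saturation_mul_re_sub_le (k : ℝ) {z z' : ℂ} {m : ℝ} (h : ‖z - z'‖ ≤ m) :
    |saturation (k * z.re) - saturation (k * z'.re)| ≤ |k| * m := by
  refine (abs_saturation_sub_le _ _).trans ?_
  rw [← mul_sub, abs_mul, ← Complex.sub_re]
  gcongr
  exact (Complex.abs_re_le_norm _).trans h

theorem Complex.norm_exp_neg_sub_mul_I_le {z : ℂ} (s : ℝ) (hz : ‖z‖ ≤ 1) :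
    ‖Complex.exp (-z - s * Complex.I)‖ ≤ 3 := by
  have h := (abs_le.mp ((Complex.abs_re_le_norm z).trans hz)).1
  exact Complex.norm_exp_le_three (by simp; linarith)

theorem norm_driveA_sub_le (k₁ s : ℝ) {c c' d d' : ℝ} {z z' w w' : ℂ} {m n : ℝ}
    (hz : ‖z‖ ≤ 1) (hz' : ‖z'‖ ≤ 1) (hw : ‖w‖ ≤ 1) (hw' : ‖w'‖ ≤ 1)
    (hzz : ‖z - z'‖ ≤ m) (hww : ‖w - w'‖ ≤ m) (hc : |c - c'| ≤ n) (hd : |d - d'| ≤ n) :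
    ‖driveA k₁ c d s z w - driveA k₁ c' d' s z' w'‖ ≤ 9 * (1 + |k₁|) * (m + n) := by
  have h1 := norm_exp_neg_sub_mul_I_sub_le s s hz hz'
  have h2 := abs_saturation_mul_im_sub_le k₁ (norm_exp_add_mul_I_sub_le (s + d) (s + d') hw hw')
  have h3 : |Real.sin (s - c) - Real.sin (s - c')| ≤ n := by
    have := Real.abs_sin_sub_sin_le (s - c) (s - c')
    rw [show s - c - (s - c') = -(c - c') by ring, abs_neg] at this
    exact this.trans hc
  have h4 := abs_add_le (Real.sin (s - c))
    (saturation (k₁ * (Complex.exp (w + (s + d : ℝ) * Complex.I)).im))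
  have h5 := Real.abs_sin_le_one (s - c)
  have h6 := abs_saturation_le_one (k₁ * (Complex.exp (w + (s + d : ℝ) * Complex.I)).im)
  have hm := (norm_nonneg _).trans hzz
  have hn := (abs_nonneg _).trans hc
  rw [show s + d - (s + d') = d - d' by ring] at h2
  rw [sub_self, abs_zero, add_zero] at h1
  have hk := abs_nonneg k₁
  have h7 : |Real.sin (s - c) + saturation (k₁ * (Complex.exp (w + (s + d : ℝ) * Complex.I)).im)
      - (Real.sin (s - c')
        + saturation (k₁ * (Complex.exp (w' + (s + d' : ℝ) * Complex.I)).im))|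
      ≤ n + |k₁| * (3 * (m + n)) := by
    rw [add_sub_add_comm]
    refine (abs_add_le _ _).trans (add_le_add h3 (h2.trans ?_))
    gcongr
  refine (norm_mul_ofReal_sub_le (Complex.norm_exp_neg_sub_mul_I_le s hz') (h4.trans
    (add_le_add h5 h6)) h1 h7).trans ?_
  nlinarith [mul_nonneg hk hm, mul_nonneg hk hn]

theorem norm_driveB_sub_le (k₂ s : ℝ) {d d' : ℝ} {z z' w w' : ℂ} {m n : ℝ}
    (hz : ‖z‖ ≤ 1) (hz' : ‖z'‖ ≤ 1) (hw : ‖w‖ ≤ 1) (hw' : ‖w'‖ ≤ 1)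
    (hzz : ‖z - z'‖ ≤ m) (hww : ‖w - w'‖ ≤ m) (hd : |d - d'| ≤ n) :
    ‖driveB k₂ d s z w - driveB k₂ d' s z' w'‖ ≤ 9 * (1 + |k₂|) * (m + n) := by
  have h1 := norm_exp_neg_sub_mul_I_sub_le (s + d) (s + d') hw hw'
  have h2 := abs_saturation_mul_re_sub_le k₂ (norm_exp_add_mul_I_sub_le s s hz hz')
  have h6 := abs_saturation_le_one (k₂ * (Complex.exp (z + s * Complex.I)).re)
  have hm := (norm_nonneg _).trans hzz
  have hn := (abs_nonneg _).trans hd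
  rw [show s + d - (s + d') = d - d' by ring] at h1
  rw [sub_self, abs_zero, add_zero] at h2
  have hk := abs_nonneg k₂
  have h2' : |k₂| * (3 * ‖z - z'‖) ≤ |k₂| * (3 * m) := by gcongr
  refine (norm_mul_ofReal_sub_le (Complex.norm_exp_neg_sub_mul_I_le (s + d') hw') h6 h1
    (h2.trans h2')).trans ?_
  nlinarith [mul_nonneg hk hm, mul_nonneg hk hn]

theorem continuous_driveA (k₁ c d : ℝ) {U V : ℝ → ℂ} (hU : Continuous U) (hV : Continuous V) :
    Continuous fun s => driveA k₁ c d s (U s) (V s) := by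
  unfold driveA
  have := continuous_saturation
  fun_prop

theorem continuous_driveB (k₂ d : ℝ) {U V : ℝ → ℂ} (hU : Continuous U) (hV : Continuous V) :
    Continuous fun s => driveB k₂ d s (U s) (V s) := by
  unfold driveB
  have := continuous_saturation
  fun_prop

theorem driveA_add_two_pi (k₁ c d s : ℝ) (z w : ℂ) :
    driveA k₁ c d (s + 2 * Real.pi) z w = driveA k₁ c d s z w := by
  have h1 : -z - ((s + 2 * Real.pi : ℝ) : ℂ) * Complex.I
      = -z - s * Complex.I - 2 * Real.pi * Complex.I := by push_cast; ring
  have h2 : w + ((s + 2 * Real.pi + d : ℝ) : ℂ) * Complex.I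
      = w + (s + d : ℝ) * Complex.I + 2 * Real.pi * Complex.I := by push_cast; ring
  rw [driveA, h1, h2, Complex.exp_periodic.sub_eq, Complex.exp_periodic, add_sub_right_comm,
    Real.sin_add_two_pi, driveA]

theorem driveB_add_two_pi (k₂ d s : ℝ) (z w : ℂ) :
    driveB k₂ d (s + 2 * Real.pi) z w = driveB k₂ d s z w := by
  have h1 : -w - ((s + 2 * Real.pi + d : ℝ) : ℂ) * Complex.I
      = -w - (s + d : ℝ) * Complex.I - 2 * Real.pi * Complex.I := by push_cast; ring
  have h2 : z + ((s + 2 * Real.pi : ℝ) : ℂ) * Complex.I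
      = z + s * Complex.I + 2 * Real.pi * Complex.I := by push_cast; ring
  rw [driveB, h1, h2, Complex.exp_periodic.sub_eq, Complex.exp_periodic, driveB]

/-! ### Logarithmic coordinates -/

theorem HasDerivAt.complex_re {f : ℝ → ℂ} {f' : ℂ} {t : ℝ} (h : HasDerivAt f f' t) :
    HasDerivAt (fun s => (f s).re) f'.re t :=
  Complex.reCLM.hasFDerivAt.comp_hasDerivAt t h

theorem HasDerivAt.complex_im {f : ℝ → ℂ} {f' : ℂ} {t : ℝ} (h : HasDerivAt f f' t) :
    HasDerivAt (fun s => (f s).im) f'.im t :=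
  Complex.imCLM.hasFDerivAt.comp_hasDerivAt t h

theorem HasDerivAt.complex_mk {f g : ℝ → ℝ} {f' g' t : ℝ} (hf : HasDerivAt f f' t)
    (hg : HasDerivAt g g' t) : HasDerivAt (fun t => (⟨f t, g t⟩ : ℂ)) ⟨f', g'⟩ t := by
  have := hf.ofReal_comp.add (hg.ofReal_comp.mul_const Complex.I)
  simp only [Complex.mk_eq_add_mul_I]
  exact this

theorem Function.Periodic.exists_forall_le {f : ℝ → ℝ} {T : ℝ} (hf : Function.Periodic f T)
    (hT : 0 < T) (hc : Continuous f) : ∃ s₀, ∀ s, f s ≤ f s₀ := by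
  obtain ⟨s₀, -, h⟩ := isCompact_Icc.exists_isMaxOn (Set.nonempty_Icc.mpr hT.le) hc.continuousOn
  refine ⟨s₀, fun s => ?_⟩
  obtain ⟨y, hy, hfy⟩ := hf.exists_mem_Ico₀ hT s
  rw [hfy]
  exact h (Set.Ico_subset_Icc_self hy)

/-- The equations of the perturbed system for `2π`-periodic logarithmic coordinates `U`, `V`:
with `s = t + c`, `x₂ + i x₁ = exp (U + i s)` and `x₄ + i x₃ = exp (V + i (s + d))`. -/
structure IsPhaseSolution (k₁ k₂ ε c d : ℝ) (U V : ℝ → ℂ) : Prop where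
  hasDerivAt_fst : ∀ s, HasDerivAt U
    (((1 - Real.exp (2 * (U s).re) : ℝ) : ℂ) + ε * driveA k₁ c d s (U s) (V s)) s
  hasDerivAt_snd : ∀ s, HasDerivAt V
    (((1 - Real.exp (2 * (V s).re) : ℝ) : ℂ) + ε * driveB k₂ d s (U s) (V s)) s
  periodic_fst : Function.Periodic U (2 * Real.pi)
  periodic_snd : Function.Periodic V (2 * Real.pi)

/-- The trajectory in `ℝ⁴` with logarithmic coordinates `U`, `V` and phases `c`, `c + d`. -/
noncomputable def phaseTrajectory (c d : ℝ) (U V : ℝ → ℂ) (t : ℝ) : Fin 4 → ℝ :=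
  ![(Complex.exp (U (t + c) + (t + c : ℝ) * Complex.I)).im,
    (Complex.exp (U (t + c) + (t + c : ℝ) * Complex.I)).re,
    (Complex.exp (V (t + c) + (t + c + d : ℝ) * Complex.I)).im,
    (Complex.exp (V (t + c) + (t + c + d : ℝ) * Complex.I)).re]

namespace IsPhaseSolution

variable {k₁ k₂ ε c d : ℝ} {U V : ℝ → ℂ}

theorem continuous_fst (h : IsPhaseSolution k₁ k₂ ε c d U V) : Continuous U :=
  continuous_iff_continuousAt.mpr fun s => (h.hasDerivAt_fst s).continuousAt

theorem continuous_snd (h : IsPhaseSolution k₁ k₂ ε c d U V) : Continuous V :=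
  continuous_iff_continuousAt.mpr fun s => (h.hasDerivAt_snd s).continuousAt

end IsPhaseSolution

theorem Complex.sq_re_add_sq_im_exp (z : ℂ) :
    (Complex.exp z).re ^ 2 + (Complex.exp z).im ^ 2 = Real.exp (2 * z.re) := by
  have h := Complex.sq_norm (Complex.exp z)
  rw [Complex.norm_exp, Complex.normSq_apply, ← Real.exp_nat_mul] at h
  push_cast at h
  rw [h]; ring

/-- The oscillator equation satisfied by `exp (U + i (t + e))` when `U` solves the logarithmic equation. -/
theorem hasDerivAt_exp_add_mul_I {U : ℝ → ℂ} {t c e ε g : ℝ} {f : ℂ}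
    (hU : HasDerivAt U (((1 - Real.exp (2 * (U (t + c)).re) : ℝ) : ℂ) + ε * f) (t + c))
    (hf : f = Complex.exp (-U (t + c) - (t + e : ℝ) * Complex.I) * (g : ℂ)) :
    HasDerivAt (fun t : ℝ => Complex.exp (U (t + c) + (t + e : ℝ) * Complex.I))
      (Complex.exp (U (t + c) + (t + e : ℝ) * Complex.I) *
        (((1 - Real.exp (2 * (U (t + c)).re) : ℝ) : ℂ) + Complex.I) + (ε * g : ℝ)) t := by
  have h1 : HasDerivAt (fun t : ℝ => ((t + e : ℝ) : ℂ) * Complex.I) (1 * Complex.I) t := by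
    have := ((hasDerivAt_id t).add_const e).ofReal_comp.mul_const Complex.I
    simpa using this
  have h2 := ((hU.comp_add_const t c).add h1).cexp
  refine h2.congr_deriv ?_
  have h3 : Complex.exp (U (t + c) + (t + e : ℝ) * Complex.I) * f = g := by
    rw [hf, ← mul_assoc, ← Complex.exp_add]
    rw [show U (t + c) + (t + e : ℝ) * Complex.I + (-U (t + c) - (t + e : ℝ) * Complex.I) = 0 by
      ring, Complex.exp_zero, one_mul]
  rw [Complex.ofReal_mul, ← h3]
  simp only [Pi.add_apply]
  ring

theorem IsPhaseSolution.isPeriodicSolution {k₁ k₂ ε c d : ℝ} {U V : ℝ → ℂ}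
    (h : IsPhaseSolution k₁ k₂ ε c d U V) :
    IsPeriodicSolution k₁ k₂ ε (phaseTrajectory c d U V) := by
  constructor
  · intro t
    have hz := hasDerivAt_exp_add_mul_I (e := c)
      (g := Real.sin t + saturation
        (k₁ * (Complex.exp (V (t + c) + (t + c + d : ℝ) * Complex.I)).im))
      (h.hasDerivAt_fst (t + c)) (by rw [driveA, add_sub_cancel_right])
    have hw := hasDerivAt_exp_add_mul_I (e := c + d)
      (g := saturation (k₂ * (Complex.exp (U (t + c) + (t + c : ℝ) * Complex.I)).re))
      (h.hasDerivAt_snd (t + c)) (by rw [driveB, add_assoc])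
    have hz1 := Complex.sq_re_add_sq_im_exp (U (t + c) + (t + c : ℝ) * Complex.I)
    have hw1 := Complex.sq_re_add_sq_im_exp (V (t + c) + (t + c + d : ℝ) * Complex.I)
    simp only [← add_assoc] at hw
    rw [show (U (t + c) + (t + c : ℝ) * Complex.I).re = (U (t + c)).re by simp] at hz1
    rw [show (V (t + c) + (t + c + d : ℝ) * Complex.I).re = (V (t + c)).re by simp] at hw1
    rw [← hz1] at hz
    rw [← hw1] at hw
    rw [hasDerivAt_pi]
    intro i
    fin_cases i
    · refine hz.complex_im.congr_deriv ?_
      simp only [oscillatorField, phaseTrajectory]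
      simp [-Complex.ofReal_pow, -Complex.ofReal_add, -Complex.ofReal_sub, -Complex.ofReal_mul,
        -Complex.ofReal_sin]
      ring
    · refine hz.complex_re.congr_deriv ?_
      simp only [oscillatorField, phaseTrajectory]
      simp [-Complex.ofReal_pow, -Complex.ofReal_add, -Complex.ofReal_sub, -Complex.ofReal_mul,
        -Complex.ofReal_sin]
      ring
    · refine hw.complex_im.congr_deriv ?_
      simp only [oscillatorField, phaseTrajectory]
      simp [-Complex.ofReal_pow, -Complex.ofReal_add, -Complex.ofReal_sub, -Complex.ofReal_mul,
        -Complex.ofReal_sin]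
      ring
    · refine hw.complex_re.congr_deriv ?_
      simp only [oscillatorField, phaseTrajectory]
      simp [-Complex.ofReal_pow, -Complex.ofReal_add, -Complex.ofReal_sub, -Complex.ofReal_mul,
        -Complex.ofReal_sin]
      ring
  · intro t
    have h1 : ((t + 2 * Real.pi + c : ℝ) : ℂ) * Complex.I
      = (t + c : ℝ) * Complex.I + 2 * Real.pi * Complex.I := by push_cast; ring
    have h2 : ((t + 2 * Real.pi + c + d : ℝ) : ℂ) * Complex.I
      = (t + c + d : ℝ) * Complex.I + 2 * Real.pi * Complex.I := by push_cast; ring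
    have h3 : t + 2 * Real.pi + c = t + c + 2 * Real.pi := by ring
    rw [phaseTrajectory, h1, h2, h3, h.periodic_fst, h.periodic_snd, ← add_assoc, ← add_assoc,
      Complex.exp_periodic, Complex.exp_periodic, phaseTrajectory]

/-- At a maximum of `‖Z‖²` the restoring term dominates the forcing as soon as `‖Z‖ > 2`. -/
theorem norm_le_two_of_periodic {Z G : ℝ → ℂ}
    (hZ : ∀ s, HasDerivAt Z (Z s * ((1 - ‖Z s‖ ^ 2 : ℝ) : ℂ) + G s) s)
    (hp : Function.Periodic Z (2 * Real.pi)) (hG : ∀ s, ‖G s‖ ≤ 2) (s : ℝ) : ‖Z s‖ ≤ 2 := by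
  have hc : Continuous Z := continuous_iff_continuousAt.mpr fun s => (hZ s).continuousAt
  have hp' : Function.Periodic (fun s => ‖Z s‖ ^ 2) (2 * Real.pi) := fun s => by simp only [hp s]
  obtain ⟨s₀, hs₀⟩ := hp'.exists_forall_le Real.two_pi_pos (by fun_prop)
  have h0 := IsLocalMax.hasDerivAt_eq_zero (Filter.Eventually.of_forall hs₀) (hZ s₀).norm_sq
  have h1 : inner ℝ (Z s₀) (Z s₀ * ((1 - ‖Z s₀‖ ^ 2 : ℝ) : ℂ))
      = (1 - ‖Z s₀‖ ^ 2) * ‖Z s₀‖ ^ 2 := by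
    rw [mul_comm, ← Complex.real_smul, inner_smul_right, real_inner_self_eq_norm_sq]
  have h2 := real_inner_le_norm (Z s₀) (G s₀)
  have h3 : ‖Z s₀‖ * ‖G s₀‖ ≤ ‖Z s₀‖ * 2 := by gcongr; exact hG s₀
  rw [inner_add_right, h1] at h0
  have h4 : ‖Z s₀‖ ≤ 2 := by
    by_contra! hlt
    nlinarith [norm_nonneg (Z s₀), mul_pos (show 0 < ‖Z s₀‖ by linarith)
      (show 0 < ‖Z s₀‖ - 2 by linarith), mul_pos (mul_pos (show 0 < ‖Z s₀‖ by linarith)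
      (show 0 < ‖Z s₀‖ - 2 by linarith)) (show 0 < ‖Z s₀‖ by linarith)]
  exact (pow_le_pow_iff_left₀ (norm_nonneg _) (norm_nonneg _) two_ne_zero).mp (hs₀ s) |>.trans h4

/-- Every point of the unit circle is an equilibrium of the unforced amplitude equation, so
Gronwall's inequality keeps a periodic forced solution near the equilibrium `1`. -/
theorem norm_sub_one_le_of_periodic {Z G : ℝ → ℂ} {s₀ δ ε : ℝ}
    (hZ : ∀ s, HasDerivAt Z (Z s * ((1 - ‖Z s‖ ^ 2 : ℝ) : ℂ) + G s) s)
    (hp : Function.Periodic Z (2 * Real.pi)) (hG : ∀ s, ‖G s‖ ≤ 2 * ε) (hε : 0 ≤ ε) (hε1 : ε ≤ 1)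
    (hδ : ‖Z s₀ - 1‖ ≤ δ) (s : ℝ) : ‖Z s - 1‖ ≤ Real.exp (12 * Real.pi) * (δ + ε) := by
  have hc : Continuous Z := continuous_iff_continuousAt.mpr fun s => (hZ s).continuousAt
  have hb := norm_le_two_of_periodic hZ hp (fun s => (hG s).trans (by linarith))
  obtain ⟨y, hy, hZy⟩ := hp.exists_mem_Ico Real.two_pi_pos s s₀
  rw [hZy]
  have key := norm_le_gronwallBound_of_norm_deriv_right_le (f := fun s => Z s - 1)
    (f' := fun s => Z s * ((1 - ‖Z s‖ ^ 2 : ℝ) : ℂ) + G s) (δ := δ) (K := 6) (ε := 2 * ε)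
    (a := s₀) (b := s₀ + 2 * Real.pi) (by fun_prop)
    (fun x _ => ((hZ x).sub_const 1).hasDerivWithinAt) hδ (fun x _ => by
      refine (norm_add_le _ _).trans (add_le_add ?_ (hG x))
      rw [norm_mul, Complex.norm_real, Real.norm_eq_abs,
        show 1 - ‖Z x‖ ^ 2 = -((‖Z x‖ - ‖(1 : ℂ)‖) * (‖Z x‖ + 1)) by rw [norm_one]; ring,
        abs_neg, abs_mul, abs_of_nonneg (show 0 ≤ ‖Z x‖ + 1 by positivity)]
      have h1 := abs_norm_sub_norm_le (Z x) 1
      have h2 := hb x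
      calc ‖Z x‖ * (|‖Z x‖ - ‖(1 : ℂ)‖| * (‖Z x‖ + 1))
          ≤ 2 * (‖Z x - 1‖ * (2 + 1)) := by gcongr
        _ = 6 * ‖Z x - 1‖ := by ring) y (Set.Ico_subset_Icc_self hy)
  refine key.trans ?_
  rw [gronwallBound_of_K_ne_0 (by norm_num)]
  have hE : Real.exp (6 * (y - s₀)) ≤ Real.exp (12 * Real.pi) :=
    Real.exp_le_exp.mpr (by linarith [hy.2])
  have hδ0 := (norm_nonneg _).trans hδ
  have hE0 := Real.exp_pos (6 * (y - s₀))
  calc δ * Real.exp (6 * (y - s₀)) + 2 * ε / 6 * (Real.exp (6 * (y - s₀)) - 1)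
      ≤ δ * Real.exp (6 * (y - s₀)) + ε * Real.exp (6 * (y - s₀)) := by nlinarith
    _ = Real.exp (6 * (y - s₀)) * (δ + ε) := by ring
    _ ≤ _ := by gcongr

/-- `U` is the principal logarithm of `Z`, which stays in a disc around `1`. -/
theorem exists_log_of_norm_sub_one_le {Z G : ℝ → ℂ} {m : ℝ}
    (hZ : ∀ s, HasDerivAt Z (Z s * ((1 - ‖Z s‖ ^ 2 : ℝ) : ℂ) + G s) s)
    (hp : Function.Periodic Z (2 * Real.pi)) (h1 : ∀ s, ‖Z s - 1‖ ≤ m) (hm : m ≤ 1 / 2) :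
    ∃ U : ℝ → ℂ, (∀ s, HasDerivAt U (((1 - Real.exp (2 * (U s).re) : ℝ) : ℂ)
        + Complex.exp (-U s) * G s) s) ∧ Function.Periodic U (2 * Real.pi) ∧
      (∀ s, ‖U s‖ ≤ 2 * m) ∧ ∀ s, Complex.exp (U s) = Z s := by
  have hZ1 : ∀ s, 1 + (Z s - 1) = Z s := fun s => by ring
  have hs : ∀ s, Z s ∈ Complex.slitPlane := fun s => by
    rw [← hZ1]
    exact Complex.mem_slitPlane_of_norm_lt_one ((h1 s).trans_lt (by linarith))
  have he : ∀ s, Complex.exp (Complex.log (Z s)) = Z s := fun s =>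
    Complex.exp_log (Complex.slitPlane_ne_zero (hs s))
  refine ⟨fun s => Complex.log (Z s), fun s => ?_, fun s => by simp only [hp s], fun s => ?_, he⟩
  · refine ((hZ s).clog_real (hs s)).congr_deriv ?_
    have h0 := Complex.slitPlane_ne_zero (hs s)
    have h2 : Real.exp (2 * (Complex.log (Z s)).re) = ‖Z s‖ ^ 2 := by
      rw [← Complex.sq_re_add_sq_im_exp, he, Complex.sq_norm, Complex.normSq_apply]; ring
    rw [h2, Complex.exp_neg, he]
    field_simp
  · have h2 := Complex.norm_log_one_add_half_le_self ((h1 s).trans hm)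
    rw [hZ1] at h2
    linarith [h1 s, norm_nonneg (Z s - 1)]

/-! ### Periodic solutions near the torus -/

/-- A periodic solution of one forced oscillator that starts near `exp (i (θ + d))` has a small
periodic logarithm in the frame rotating with the unperturbed motion. -/
theorem exists_log_coordinate {z : ℝ → ℂ} {g : ℝ → ℝ} {ε δ θ d : ℝ}
    (hz : ∀ t, HasDerivAt z
      (z t * (((1 - ‖z t‖ ^ 2 : ℝ) : ℂ) + Complex.I) + (ε * g t : ℝ)) t)
    (hp : Function.Periodic z (2 * Real.pi)) (hg : ∀ t, |g t| ≤ 2) (hε : 0 ≤ ε) (hε1 : ε ≤ 1)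
    (hδ : ‖z 0 - Complex.exp ((θ + d : ℝ) * Complex.I)‖ ≤ δ)
    (hm : Real.exp (12 * Real.pi) * (δ + ε) ≤ 1 / 2) :
    ∃ U : ℝ → ℂ, (∀ s, HasDerivAt U (((1 - Real.exp (2 * (U s).re) : ℝ) : ℂ)
        + ε * (Complex.exp (-U s - (s + d : ℝ) * Complex.I) * (g (s - θ) : ℂ))) s) ∧
      Function.Periodic U (2 * Real.pi) ∧
      (∀ s, ‖U s‖ ≤ 2 * (Real.exp (12 * Real.pi) * (δ + ε))) ∧
      ∀ t, z t = Complex.exp (U (t + θ) + (t + θ + d : ℝ) * Complex.I) := by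
  set E : ℝ → ℂ := fun s => Complex.exp (-((s + d : ℝ) * Complex.I)) with hE
  have hEn : ∀ s, ‖E s‖ = 1 := fun s => by
    simp only [hE]; rw [← neg_mul, ← Complex.ofReal_neg]; exact Complex.norm_exp_ofReal_mul_I _
  have hEd : ∀ s, HasDerivAt E (-(E s * Complex.I)) s := fun s => by
    have h1 : HasDerivAt (fun s : ℝ => -(((s + d : ℝ) : ℂ) * Complex.I)) (-(1 * Complex.I)) s := by
      have := (((hasDerivAt_id s).add_const d).ofReal_comp.mul_const Complex.I).neg
      rw [Complex.ofReal_one] at this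
      exact this
    refine h1.cexp.congr_deriv ?_
    simp only [hE]; ring
  have hEp : Function.Periodic E (2 * Real.pi) := fun s => by
    simp only [hE]
    rw [show -(((s + 2 * Real.pi + d : ℝ) : ℂ) * Complex.I)
      = -((s + d : ℝ) * Complex.I) - 2 * Real.pi * Complex.I by push_cast; ring,
      Complex.exp_periodic.sub_eq]
  have hZ : ∀ s, HasDerivAt (fun s => E s * z (s - θ))
      (E s * z (s - θ) * ((1 - ‖E s * z (s - θ)‖ ^ 2 : ℝ) : ℂ)
        + E s * ((ε * g (s - θ) : ℝ) : ℂ)) s := fun s => by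
    refine ((hEd s).mul ((hz (s - θ)).comp_sub_const s θ)).congr_deriv ?_
    rw [norm_mul, hEn, one_mul]
    ring
  have hZp : Function.Periodic (fun s => E s * z (s - θ)) (2 * Real.pi) := fun s => by
    simp only [hEp s]
    rw [show s + 2 * Real.pi - θ = s - θ + 2 * Real.pi by ring, hp]
  have hZ1 : ∀ s, ‖E s * z (s - θ) - 1‖ ≤ Real.exp (12 * Real.pi) * (δ + ε) := by
    refine norm_sub_one_le_of_periodic (s₀ := θ) hZ hZp (fun s => ?_) hε hε1 ?_
    · rw [norm_mul, hEn, one_mul, Complex.norm_real, Real.norm_eq_abs, abs_mul, abs_of_nonneg hε]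
      nlinarith [hg (s - θ)]
    · have : E θ * z (θ - θ) - 1 = E θ * (z 0 - Complex.exp ((θ + d : ℝ) * Complex.I)) := by
        rw [sub_self, mul_sub, hE, ← Complex.exp_add, neg_add_cancel, Complex.exp_zero]
      rw [this, norm_mul, hEn, one_mul]
      exact hδ
  obtain ⟨U, hU, hUp, hUn, hUe⟩ := exists_log_of_norm_sub_one_le hZ hZp hZ1 hm
  refine ⟨U, fun s => (hU s).congr_deriv ?_, hUp, hUn, fun t => ?_⟩
  · rw [sub_eq_add_neg (-U s), Complex.exp_add]
    simp only [hE]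
    push_cast
    ring
  · rw [Complex.exp_add, hUe, add_sub_cancel_right, mul_right_comm, hE, ← Complex.exp_add,
      neg_add_cancel, Complex.exp_zero, one_mul]

theorem Complex.norm_sub_le_of_re_im {z w : ℂ} {δ : ℝ} (h1 : |z.re - w.re| ≤ δ)
    (h2 : |z.im - w.im| ≤ δ) : ‖z - w‖ ≤ 2 * δ := by
  have := Complex.norm_le_abs_re_add_abs_im (z - w)
  rw [Complex.sub_re, Complex.sub_im] at this
  linarith

theorem IsPeriodicSolution.exists_isPhaseSolution {k₁ k₂ ε δ θ η : ℝ} {y : ℝ → Fin 4 → ℝ}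
    (hy : IsPeriodicSolution k₁ k₂ ε y) (hε : 0 ≤ ε) (hε1 : ε ≤ 1)
    (hδ : dist (y 0) (torusPoint θ η) ≤ δ)
    (hm : Real.exp (12 * Real.pi) * (2 * δ + ε) ≤ 1 / 2) :
    ∃ U V, IsPhaseSolution k₁ k₂ ε θ (η - θ) U V ∧
      (∀ s, ‖U s‖ ≤ 2 * (Real.exp (12 * Real.pi) * (2 * δ + ε))) ∧
      (∀ s, ‖V s‖ ≤ 2 * (Real.exp (12 * Real.pi) * (2 * δ + ε))) ∧
      y = phaseTrajectory θ (η - θ) U V := by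
  obtain ⟨hd, hp⟩ := hy
  have hδi : ∀ i, |y 0 i - torusPoint θ η i| ≤ δ := fun i =>
    (dist_le_pi_dist (y 0) (torusPoint θ η) i).trans hδ
  have hdi := fun t => hasDerivAt_pi.mp (hd t)
  have hn : ∀ a b : ℝ, ‖(⟨a, b⟩ : ℂ)‖ ^ 2 = b ^ 2 + a ^ 2 := fun a b => by
    rw [Complex.sq_norm, Complex.normSq_apply]; ring
  obtain ⟨U, hU, hUp, hUn, hUe⟩ := exists_log_coordinate (z := fun t => ⟨y t 1, y t 0⟩)
    (g := fun t => Real.sin t + saturation (k₁ * y t 2)) (θ := θ) (d := 0)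
    (fun t => ((hdi t 1).complex_mk (hdi t 0)).congr_deriv (by
      rw [hn]
      apply Complex.ext <;> simp [oscillatorField, -Complex.ofReal_pow, -Complex.ofReal_add,
        -Complex.ofReal_sub, -Complex.ofReal_mul, -Complex.ofReal_sin] <;> ring))
    (fun t => by simp only [hp t])
    (fun t => by
      have h1 := abs_add_le (Real.sin t) (saturation (k₁ * y t 2))
      have h2 := Real.abs_sin_le_one t
      have h3 := abs_saturation_le_one (k₁ * y t 2)
      linarith) hε hε1
    (Complex.norm_sub_le_of_re_im
      (by rw [add_zero, Complex.exp_ofReal_mul_I_re]; simpa [torusPoint] using hδi 1)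
      (by rw [add_zero, Complex.exp_ofReal_mul_I_im]; simpa [torusPoint] using hδi 0)) hm
  obtain ⟨V, hV, hVp, hVn, hVe⟩ := exists_log_coordinate (z := fun t => ⟨y t 3, y t 2⟩)
    (g := fun t => saturation (k₂ * y t 1)) (θ := θ) (d := η - θ)
    (fun t => ((hdi t 3).complex_mk (hdi t 2)).congr_deriv (by
      rw [hn]
      apply Complex.ext <;> simp [oscillatorField, -Complex.ofReal_pow, -Complex.ofReal_add,
        -Complex.ofReal_sub, -Complex.ofReal_mul] <;> ring))
    (fun t => by simp only [hp t])
    (fun t => (abs_saturation_le_one _).trans (by norm_num)) hε hε1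
    (Complex.norm_sub_le_of_re_im
      (by rw [add_sub_cancel, Complex.exp_ofReal_mul_I_re]; simpa [torusPoint] using hδi 3)
      (by rw [add_sub_cancel, Complex.exp_ofReal_mul_I_im]; simpa [torusPoint] using hδi 2)) hm
  simp only [add_zero] at hU hUe
  refine ⟨U, V, ⟨fun s => ?_, fun s => ?_, hUp, hVp⟩, hUn, hVn, funext fun t => ?_⟩
  · have h := congrArg Complex.im (hVe (s - θ))
    simp only [sub_add_cancel] at h
    rw [driveA, ← h]
    exact hU s
  · have h := congrArg Complex.re (hUe (s - θ))
    simp only [sub_add_cancel] at h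
    rw [driveB, ← h]
    exact hV s
  · rw [phaseTrajectory, ← hUe, ← hVe]
    ext i
    fin_cases i <;> rfl

/-! ### Means over a period -/

/-- The mean value of a `2π`-periodic function. -/
noncomputable def periodMean (f : ℝ → ℝ) : ℝ :=
  (2 * Real.pi)⁻¹ * ∫ s in (0 : ℝ)..2 * Real.pi, f s

theorem periodMean_add {f g : ℝ → ℝ} (hf : Continuous f) (hg : Continuous g) :
    periodMean (fun s => f s + g s) = periodMean f + periodMean g := by
  rw [periodMean, intervalIntegral.integral_add (hf.intervalIntegrable _ _)
    (hg.intervalIntegrable _ _), mul_add]; rfl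

theorem periodMean_sub {f g : ℝ → ℝ} (hf : Continuous f) (hg : Continuous g) :
    periodMean (fun s => f s - g s) = periodMean f - periodMean g := by
  rw [periodMean, intervalIntegral.integral_sub (hf.intervalIntegrable _ _)
    (hg.intervalIntegrable _ _), mul_sub]; rfl

theorem periodMean_const_mul (a : ℝ) (f : ℝ → ℝ) :
    periodMean (fun s => a * f s) = a * periodMean f := by
  rw [periodMean, intervalIntegral.integral_const_mul, periodMean]; ring

theorem periodMean_const (a : ℝ) : periodMean (fun _ => a) = a := by
  have := Real.pi_ne_zero
  rw [periodMean, intervalIntegral.integral_const, smul_eq_mul]; field_simp; ring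

theorem abs_periodMean_le {f : ℝ → ℝ} {m : ℝ} (h : ∀ s, |f s| ≤ m) : |periodMean f| ≤ m := by
  have h1 := intervalIntegral.norm_integral_le_of_norm_le_const (f := f) (a := 0)
    (b := 2 * Real.pi) (C := m) (fun s _ => h s)
  have hpi := Real.two_pi_pos
  rw [sub_zero, abs_of_pos hpi, Real.norm_eq_abs] at h1
  rw [periodMean, abs_mul, abs_of_pos (inv_pos.mpr hpi), inv_mul_le_iff₀ hpi, mul_comm _ m]
  exact h1

theorem abs_periodMean_sub_le {f g : ℝ → ℝ} {m : ℝ} (hf : Continuous f) (hg : Continuous g)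
    (h : ∀ s, |f s - g s| ≤ m) : |periodMean f - periodMean g| ≤ m := by
  rw [← periodMean_sub hf hg]
  exact abs_periodMean_le h

theorem periodMean_eq_zero_of_hasDerivAt {F f : ℝ → ℝ} (h : ∀ s, HasDerivAt F (f s) s)
    (hf : Continuous f) (hF : Function.Periodic F (2 * Real.pi)) : periodMean f = 0 := by
  have h0 := hF 0
  rw [zero_add] at h0
  rw [periodMean, intervalIntegral.integral_eq_sub_of_hasDerivAt (fun s _ => h s)
    (hf.intervalIntegrable _ _), h0, sub_self, mul_zero]

theorem periodMean_pos {f : ℝ → ℝ} (hf : Continuous f) (h0 : ∀ s, 0 ≤ f s)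
    (h1 : ∃ s ∈ Set.Icc 0 (2 * Real.pi), 0 < f s) : 0 < periodMean f :=
  mul_pos (inv_pos.mpr Real.two_pi_pos) (intervalIntegral.integral_pos Real.two_pi_pos
    hf.continuousOn (fun s _ => h0 s) h1)

theorem periodMean_eq_zero_of_odd {f : ℝ → ℝ} (h : ∀ s, f (2 * Real.pi - s) = -f s) :
    periodMean f = 0 := by
  have h1 := intervalIntegral.integral_comp_sub_left (a := 0) (b := 2 * Real.pi) f (2 * Real.pi)
  simp only [h, intervalIntegral.integral_neg, sub_self, sub_zero] at h1
  rw [periodMean, show ∫ s in (0 : ℝ)..2 * Real.pi, f s = 0 by linarith, mul_zero]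

theorem periodMean_sin_mul_sin : periodMean (fun s => Real.sin s * Real.sin s) = 1 / 2 := by
  have h := integral_sin_sq (a := 0) (b := 2 * Real.pi)
  have hpi := Real.pi_ne_zero
  simp only [← pow_two]
  rw [periodMean, h]
  simp
  field_simp

theorem periodMean_sin_mul_cos : periodMean (fun s => Real.sin s * Real.cos s) = 0 :=
  periodMean_eq_zero_of_odd fun s => by rw [Real.sin_two_pi_sub, Real.cos_two_pi_sub]; ring

/-! ### The bifurcation equations -/

/-- The phase part of the first logarithmic equation is `(Im U)' = ε Im driveA`, and `U` is periodic. -/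
theorem IsPhaseSolution.periodMean_im_driveA {k₁ k₂ ε c d : ℝ} {U V : ℝ → ℂ} (hε : ε ≠ 0)
    (h : IsPhaseSolution k₁ k₂ ε c d U V) :
    periodMean (fun s => (driveA k₁ c d s (U s) (V s)).im) = 0 := by
  have hc := continuous_driveA k₁ c d h.continuous_fst h.continuous_snd
  have h1 := periodMean_eq_zero_of_hasDerivAt (F := fun s => (U s).im)
    (f := fun s => ε * (driveA k₁ c d s (U s) (V s)).im)
    (fun s => (h.hasDerivAt_fst s).complex_im.congr_deriv (by simp [-Complex.ofReal_sub]))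
    ((Complex.continuous_im.comp hc).const_mul ε) (fun s => by simp only [h.periodic_fst s])
  rw [periodMean_const_mul] at h1
  exact (mul_eq_zero.mp h1).resolve_left hε

theorem IsPhaseSolution.periodMean_im_driveB {k₁ k₂ ε c d : ℝ} {U V : ℝ → ℂ} (hε : ε ≠ 0)
    (h : IsPhaseSolution k₁ k₂ ε c d U V) :
    periodMean (fun s => (driveB k₂ d s (U s) (V s)).im) = 0 := by
  have hc := continuous_driveB k₂ d h.continuous_fst h.continuous_snd
  have h1 := periodMean_eq_zero_of_hasDerivAt (F := fun s => (V s).im)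
    (f := fun s => ε * (driveB k₂ d s (U s) (V s)).im)
    (fun s => (h.hasDerivAt_snd s).complex_im.congr_deriv (by simp [-Complex.ofReal_sub]))
    ((Complex.continuous_im.comp hc).const_mul ε) (fun s => by simp only [h.periodic_snd s])
  rw [periodMean_const_mul] at h1
  exact (mul_eq_zero.mp h1).resolve_left hε

/-- The first harmonic of the response of the saturation to `k sin`. -/
noncomputable def saturationGain (k : ℝ) : ℝ :=
  periodMean fun s => saturation (k * Real.sin s) * Real.sin s

theorem saturationGain_neg (k : ℝ) : saturationGain (-k) = -saturationGain k := by
  rw [saturationGain, saturationGain, neg_eq_neg_one_mul (periodMean _), ← periodMean_const_mul]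
  congr 1; ext s
  rw [neg_mul, saturation_neg]; ring

theorem saturationGain_of_abs_le {k : ℝ} (hk : |k| ≤ 1) : saturationGain k = k / 2 := by
  have : ∀ s, saturation (k * Real.sin s) * Real.sin s = k * (Real.sin s * Real.sin s) := fun s => by
    rw [saturation_of_abs_le, mul_assoc]
    rw [abs_mul]
    exact mul_le_one₀ hk (abs_nonneg _) (Real.abs_sin_le_one s)
  simp only [saturationGain, this]
  rw [periodMean_const_mul, periodMean_sin_mul_sin]; ring

theorem sq_le_saturation_mul {k x : ℝ} (hk : 1 ≤ k) (hx : |x| ≤ 1) :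
    x * x ≤ saturation (k * x) * x := by
  obtain ⟨h1, h2⟩ := abs_le.mp hx
  unfold saturation
  split_ifs <;> nlinarith [mul_self_nonneg x]

theorem half_lt_saturationGain {k : ℝ} (hk : 1 < k) : 1 / 2 < saturationGain k := by
  have hc := continuous_saturation
  have h : 0 < periodMean fun s =>
      saturation (k * Real.sin s) * Real.sin s - Real.sin s * Real.sin s := by
    refine periodMean_pos (by fun_prop)
      (fun s => sub_nonneg.mpr (sq_le_saturation_mul hk.le (Real.abs_sin_le_one s)))
      -- At this point the saturation is just reached, and `φ (k sin s) = 1 > sin s`.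
      ⟨Real.arcsin k⁻¹, ⟨Real.arcsin_nonneg.mpr (by positivity), ?_⟩, ?_⟩
    · exact (Real.arcsin_le_pi_div_two _).trans (by linarith [Real.pi_pos])
    · have hk0 : 0 < k⁻¹ := by positivity
      have hk1 : k⁻¹ < 1 := inv_lt_one_of_one_lt₀ hk
      rw [Real.sin_arcsin (by linarith) hk1.le, mul_inv_cancel₀ (by positivity),
        saturation_of_abs_le (by simp)]
      nlinarith
  rw [periodMean_sub (by fun_prop) (by fun_prop), periodMean_sin_mul_sin] at h
  exact sub_pos.mp h

theorem half_lt_abs_saturationGain {k : ℝ} (hk : 1 < |k|) : 1 / 2 < |saturationGain k| := by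
  rcases lt_abs.mp hk with h | h
  · exact (half_lt_saturationGain h).trans_le (le_abs_self _)
  · have := half_lt_saturationGain h
    rw [saturationGain_neg] at this
    exact this.trans_le (neg_le_abs _)

/-- The first harmonic of the response of the saturation to `k cos`. -/
noncomputable def saturationCosGain (k : ℝ) : ℝ :=
  periodMean fun s => saturation (k * Real.cos s) * Real.cos s

theorem saturationCosGain_pos {k : ℝ} (hk : 0 < k) : 0 < saturationCosGain k := by
  have hc := continuous_saturation
  refine periodMean_pos (by fun_prop) (fun s => ?_) ⟨0, ⟨le_rfl, Real.two_pi_pos.le⟩, ?_⟩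
  · unfold saturation
    split_ifs with h1 h2
    · nlinarith
    · nlinarith [mul_self_nonneg (Real.cos s)]
    · nlinarith
  · rw [Real.cos_zero, mul_one, mul_one]
    unfold saturation
    split_ifs <;> linarith

theorem saturationCosGain_ne_zero {k : ℝ} (hk : k ≠ 0) : saturationCosGain k ≠ 0 := by
  rcases hk.lt_or_gt with h | h
  · have h1 := saturationCosGain_pos (neg_pos.mpr h)
    have h2 : saturationCosGain (-k) = -saturationCosGain k := by
      rw [saturationCosGain, saturationCosGain, neg_eq_neg_one_mul (periodMean _), ← periodMean_const_mul]
      congr 1; ext s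
      rw [neg_mul, saturation_neg]; ring
    rw [h2] at h1
    exact (neg_pos.mp h1).ne
  · exact (saturationCosGain_pos h).ne'

theorem periodMean_saturation_cos_mul_sin (k : ℝ) :
    periodMean (fun s => saturation (k * Real.cos s) * Real.sin s) = 0 :=
  periodMean_eq_zero_of_odd fun s => by rw [Real.sin_two_pi_sub, Real.cos_two_pi_sub]; ring

theorem periodMean_im_driveB_zero (k₂ d : ℝ) :
    periodMean (fun s => (driveB k₂ d s 0 0).im) = -(Real.sin d * saturationCosGain k₂) := by
  have hc := continuous_saturation
  have : ∀ s, (driveB k₂ d s 0 0).im = -Real.sin d * (saturation (k₂ * Real.cos s) * Real.cos s)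
      + -Real.cos d * (saturation (k₂ * Real.cos s) * Real.sin s) := fun s => by
    have h1 : -0 - ((s + d : ℝ) : ℂ) * Complex.I = ((-(s + d) : ℝ) : ℂ) * Complex.I := by
      push_cast; ring
    rw [driveB, h1, zero_add, Complex.im_mul_ofReal, Complex.exp_ofReal_mul_I_im,
      Complex.exp_ofReal_mul_I_re, Real.sin_neg, Real.sin_add]
    ring
  simp only [this]
  rw [periodMean_add (by fun_prop) (by fun_prop), periodMean_const_mul, periodMean_const_mul,
    periodMean_saturation_cos_mul_sin, saturationCosGain]
  ring

theorem periodMean_im_driveA_zero (k₁ c : ℝ) {d : ℝ} (hd : Real.sin d = 0) :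
    periodMean (fun s => (driveA k₁ c d s 0 0).im)
      = -(Real.cos c / 2 + Real.cos d * saturationGain k₁) := by
  have hc := continuous_saturation
  have hcd : Real.cos d = 1 ∨ Real.cos d = -1 := by
    rw [← sq_eq_one_iff]
    have := Real.sin_sq_add_cos_sq d
    rw [hd] at this; linarith
  have : ∀ s, (driveA k₁ c d s 0 0).im = -Real.cos c * (Real.sin s * Real.sin s)
      + Real.sin c * (Real.sin s * Real.cos s)
      + -Real.cos d * (saturation (k₁ * Real.sin s) * Real.sin s) := fun s => by
    have h1 : -0 - (s : ℂ) * Complex.I = ((-s : ℝ) : ℂ) * Complex.I := by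
      push_cast; ring
    have h2 : saturation (k₁ * Real.sin (s + d)) = Real.cos d * saturation (k₁ * Real.sin s) := by
      rw [Real.sin_add, hd, mul_zero, add_zero]
      rcases hcd with h | h <;> rw [h]
      · rw [mul_one, one_mul]
      · rw [mul_neg_one, mul_neg, saturation_neg, neg_one_mul]
    rw [driveA, h1, zero_add, Complex.im_mul_ofReal, Complex.exp_ofReal_mul_I_im,
      Complex.exp_ofReal_mul_I_im, h2, Real.sin_neg, Real.sin_sub]
    ring
  simp only [this]
  rw [periodMean_add (by fun_prop) (by fun_prop), periodMean_add (by fun_prop) (by fun_prop),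
    periodMean_const_mul, periodMean_const_mul, periodMean_const_mul,
    periodMean_sin_mul_sin, periodMean_sin_mul_cos, saturationGain]
  ring

/-- The bifurcation function vanishes at every limit of initial conditions of periodic
solutions. -/
theorem IsLimitOfPeriodicSolutions.bifurcation_eq {k₁ k₂ θ η : ℝ}
    (h : IsLimitOfPeriodicSolutions k₁ k₂ (torusPoint θ η)) :
    periodMean (fun s => (driveA k₁ θ (η - θ) s 0 0).im) = 0 ∧
      periodMean (fun s => (driveB k₂ (η - θ) s 0 0).im) = 0 := by
  obtain ⟨ε, x, hε, hε0, hx, hx0⟩ := h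
  set δ : ℕ → ℝ := fun m => dist (x m 0) (torusPoint θ η) with hδ
  have hδ0 : Tendsto δ atTop (𝓝 0) := tendsto_iff_dist_tendsto_zero.mp hx0
  set M : ℕ → ℝ := fun m => Real.exp (12 * Real.pi) * (2 * δ m + ε m) with hM
  have hM0 : Tendsto M atTop (𝓝 0) := by
    have := ((hδ0.const_mul 2).add hε0).const_mul (Real.exp (12 * Real.pi))
    simpa using this
  set K : ℝ := 9 * (1 + |k₁|) + 9 * (1 + |k₂|) with hK
  have key : ∀ᶠ m in atTop,
      |periodMean (fun s => (driveA k₁ θ (η - θ) s 0 0).im)| ≤ K * (2 * M m) ∧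
      |periodMean (fun s => (driveB k₂ (η - θ) s 0 0).im)| ≤ K * (2 * M m) := by
    filter_upwards [hε0.eventually (gt_mem_nhds (show (0 : ℝ) < 1 by norm_num)),
      hM0.eventually (gt_mem_nhds (show (0 : ℝ) < 1 / 2 by norm_num))] with m h1 h2
    obtain ⟨U, V, hUV, hU, hV, -⟩ := (hx m).exists_isPhaseSolution (hε m).le h1.le le_rfl h2.le
    have hMm : 2 * M m ≤ 1 := by linarith
    have hU1 := fun s => (hU s).trans hMm
    have hV1 := fun s => (hV s).trans hMm
    have hM00 : 0 ≤ M m := by linarith [(norm_nonneg _).trans (hU 0)]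
    have hUc := hUV.continuous_fst
    have hVc := hUV.continuous_snd
    have hA := continuous_driveA k₁ θ (η - θ) hUc hVc
    have hB := continuous_driveB k₂ (η - θ) hUc hVc
    have hA0 := continuous_driveA k₁ θ (η - θ) (U := 0) (V := 0) continuous_const continuous_const
    have hB0 := continuous_driveB k₂ (η - θ) (U := 0) (V := 0) continuous_const continuous_const
    have e1 := hUV.periodMean_im_driveA (hε m).ne'
    have e2 := hUV.periodMean_im_driveB (hε m).ne'
    constructor
    · rw [← sub_zero (periodMean _), ← e1]
      refine abs_periodMean_sub_le (Complex.continuous_im.comp hA0)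
        (Complex.continuous_im.comp hA) fun s => ?_
      rw [← Complex.sub_im]
      refine (Complex.abs_im_le_norm _).trans ((norm_driveA_sub_le k₁ s (m := 2 * M m) (n := 0)
        (by simp) (hU1 s) (by simp) (hV1 s) (by simpa using hU s) (by simpa using hV s) (by simp)
        (by simp)).trans ?_)
      rw [add_zero]
      gcongr
      linarith [abs_nonneg k₂]
    · rw [← sub_zero (periodMean _), ← e2]
      refine abs_periodMean_sub_le (Complex.continuous_im.comp hB0)
        (Complex.continuous_im.comp hB) fun s => ?_
      rw [← Complex.sub_im]
      refine (Complex.abs_im_le_norm _).trans ((norm_driveB_sub_le k₂ s (m := 2 * M m) (n := 0)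
        (by simp) (hU1 s) (by simp) (hV1 s) (by simpa using hU s) (by simpa using hV s)
        (by simp)).trans ?_)
      rw [add_zero]
      gcongr
      linarith [abs_nonneg k₁]
  have hlim : Tendsto (fun m => K * (2 * M m)) atTop (𝓝 0) := by
    simpa using (hM0.const_mul 2).const_mul K
  exact ⟨abs_nonpos_iff.mp (ge_of_tendsto hlim (key.mono fun _ h => h.1)),
    abs_nonpos_iff.mp (ge_of_tendsto hlim (key.mono fun _ h => h.2))⟩

theorem IsLimitOfPeriodicSolutions.sin_eq_zero {k₁ k₂ θ η : ℝ} (hk₂ : k₂ ≠ 0)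
    (h : IsLimitOfPeriodicSolutions k₁ k₂ (torusPoint θ η)) : Real.sin (η - θ) = 0 := by
  have := h.bifurcation_eq.2
  rw [periodMean_im_driveB_zero, neg_eq_zero] at this
  exact (mul_eq_zero.mp this).resolve_right (saturationCosGain_ne_zero hk₂)

theorem IsLimitOfPeriodicSolutions.cos_eq {k₁ k₂ θ η : ℝ} (hk₂ : k₂ ≠ 0)
    (h : IsLimitOfPeriodicSolutions k₁ k₂ (torusPoint θ η)) :
    Real.cos θ = -(2 * Real.cos (η - θ) * saturationGain k₁) := by
  have := h.bifurcation_eq.1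
  rw [periodMean_im_driveA_zero _ _ (h.sin_eq_zero hk₂)] at this
  linarith

theorem not_isLimitOfPeriodicSolutions {k₁ k₂ : ℝ} (hk₂ : k₂ ≠ 0) (hk₁ : 1 < |k₁|) (θ η : ℝ) :
    ¬ IsLimitOfPeriodicSolutions k₁ k₂ (torusPoint θ η) := by
  intro h
  have h1 := h.cos_eq hk₂
  have h2 := half_lt_abs_saturationGain hk₁
  have h3 := Real.sin_sq_add_cos_sq (η - θ)
  rw [h.sin_eq_zero hk₂] at h3
  have h4 : Real.cos θ ^ 2 = 4 * |saturationGain k₁| ^ 2 := by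
    rw [h1, sq_abs]; linear_combination 4 * saturationGain k₁ ^ 2 * h3
  nlinarith [Real.cos_sq_le_one θ]

/-! ### Periodic solutions of the linearized equations -/

/-- At an extremum of `r` the derivative vanishes, hence `2 r = f` there. -/
theorem abs_le_of_hasDerivAt_neg_two_mul_add {r f : ℝ → ℝ} {A : ℝ}
    (hr : ∀ s, HasDerivAt r (-2 * r s + f s) s) (hp : Function.Periodic r (2 * Real.pi))
    (hf : ∀ s, |f s| ≤ A) (s : ℝ) : |r s| ≤ A / 2 := by
  have hc : Continuous r := continuous_iff_continuousAt.mpr fun s => (hr s).continuousAt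
  obtain ⟨s₁, h1⟩ := hp.exists_forall_le Real.two_pi_pos hc
  have hpn : Function.Periodic (fun s => -r s) (2 * Real.pi) := fun s => by simp only [hp s]
  obtain ⟨s₂, h2⟩ := hpn.exists_forall_le Real.two_pi_pos hc.neg
  have e1 := IsLocalMax.hasDerivAt_eq_zero (Filter.Eventually.of_forall h1) (hr s₁)
  have e2 := IsLocalMax.hasDerivAt_eq_zero (Filter.Eventually.of_forall h2) (hr s₂).neg
  have f1 := abs_le.mp (hf s₁)
  have f2 := abs_le.mp (hf s₂)
  exact abs_le.mpr ⟨by linarith [h2 s], by linarith [h1 s]⟩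

theorem abs_le_of_periodMean_eq_zero {r f : ℝ → ℝ} {B : ℝ}
    (hr : ∀ s, HasDerivAt r (f s) s) (hp : Function.Periodic r (2 * Real.pi))
    (h0 : periodMean r = 0) (hf : ∀ s, |f s| ≤ B) (s : ℝ) : |r s| ≤ 2 * Real.pi * B := by
  have hc : Continuous r := continuous_iff_continuousAt.mpr fun s => (hr s).continuousAt
  have hB := (abs_nonneg _).trans (hf 0)
  rw [← sub_zero (r s), ← h0, ← periodMean_const (r s)]
  refine abs_periodMean_sub_le continuous_const hc fun u => ?_
  obtain ⟨v, hv, hrv⟩ := hp.exists_mem_Ico Real.two_pi_pos u s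
  rw [hrv, abs_sub_comm]
  have := Convex.norm_image_sub_le_of_norm_hasDerivWithin_le (f := r) (f' := f) (s := Set.univ)
    (C := B) (fun x _ => (hr x).hasDerivWithinAt) (fun x _ => hf x) convex_univ
    (Set.mem_univ s) (Set.mem_univ v)
  rw [Real.norm_eq_abs, Real.norm_eq_abs, abs_of_nonneg (sub_nonneg.mpr hv.1)] at this
  refine this.trans ?_
  rw [mul_comm]
  gcongr
  linarith [hv.2]

theorem exists_periodic_hasDerivAt_neg_two_mul_add {f : ℝ → ℝ} (hf : Continuous f)
    (hp : Function.Periodic f (2 * Real.pi)) :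
    ∃ r : ℝ → ℝ, (∀ s, HasDerivAt r (-2 * r s + f s) s) ∧ Function.Periodic r (2 * Real.pi) := by
  set T : ℝ := 2 * Real.pi with hT
  set J : ℝ → ℝ := fun t => ∫ u in (0 : ℝ)..t, Real.exp (2 * u) * f u with hJ
  have hJd : ∀ t, HasDerivAt J (Real.exp (2 * t) * f t) t := fun t =>
    (show Continuous fun u => Real.exp (2 * u) * f u by fun_prop).integral_hasStrictDerivAt 0 t
      |>.hasDerivAt
  have hJ0 : J 0 = 0 := by simp [hJ]
  have hq : 1 - Real.exp (-2 * T) ≠ 0 := by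
    have : Real.exp (-2 * T) < 1 := Real.exp_lt_one_iff.mpr (by linarith [Real.two_pi_pos])
    exact (sub_pos.mpr this).ne'
  -- The initial value for which the variation-of-constants formula closes up after one period.
  set C : ℝ := Real.exp (-2 * T) * J T / (1 - Real.exp (-2 * T)) with hC
  have hCeq : Real.exp (-2 * T) * (C + J T) = C := by
    linear_combination -(div_mul_cancel₀ (Real.exp (-2 * T) * J T) hq)
  have hE : ∀ t : ℝ, HasDerivAt (fun s : ℝ => Real.exp (-2 * s)) (-2 * Real.exp (-2 * t)) t :=
    fun t => ((hasDerivAt_id t).const_mul (-2)).exp.congr_deriv (by simp only [id]; ring)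
  have hd : ∀ s, HasDerivAt (fun s => Real.exp (-2 * s) * (C + J s))
      (-2 * (Real.exp (-2 * s) * (C + J s)) + f s) s := fun s => by
    refine ((hE s).mul ((hJd s).const_add C)).congr_deriv ?_
    have h2 : Real.exp (-2 * s) * (Real.exp (2 * s) * f s) = f s := by
      rw [← mul_assoc, ← Real.exp_add, neg_mul, neg_add_cancel, Real.exp_zero, one_mul]
    rw [h2]; ring
  refine ⟨fun s => Real.exp (-2 * s) * (C + J s), hd, fun s => ?_⟩
  -- `exp (-2 T) * (C + J (t + T)) - (C + J t)` is constant and vanishes at `t = 0`.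
  have hk : ∀ t, HasDerivAt (fun t => Real.exp (-2 * T) * (C + J (t + T)) - (C + J t)) 0 t :=
    fun t => by
      refine (((((hJd (t + T)).comp_add_const t T).const_add C).const_mul _).sub
        ((hJd t).const_add C)).congr_deriv ?_
      rw [hp, ← mul_assoc, ← Real.exp_add, show -2 * T + 2 * (t + T) = 2 * t by ring, sub_self]
  have h0 := is_const_of_deriv_eq_zero (fun t => (hk t).differentiableAt)
    (fun t => (hk t).deriv) s 0
  simp only [zero_add, hJ0, add_zero, hCeq, sub_self] at h0
  beta_reduce
  rw [show -2 * (s + T) = -2 * s + -2 * T by ring, Real.exp_add, mul_assoc, sub_eq_zero.mp h0]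

theorem exists_periodic_hasDerivAt_sub_periodMean {f : ℝ → ℝ} (hf : Continuous f)
    (hp : Function.Periodic f (2 * Real.pi)) :
    ∃ r : ℝ → ℝ, (∀ s, HasDerivAt r (f s - periodMean f) s) ∧
      Function.Periodic r (2 * Real.pi) ∧ periodMean r = 0 := by
  set J : ℝ → ℝ := fun t => ∫ u in (0 : ℝ)..t, (f u - periodMean f) with hJ
  have hc : Continuous fun u => f u - periodMean f := by fun_prop
  have hJd : ∀ t, HasDerivAt J (f t - periodMean f) t := fun t =>
    (hc.integral_hasStrictDerivAt 0 t).hasDerivAt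
  have hJc : Continuous J := continuous_iff_continuousAt.mpr fun s => (hJd s).continuousAt
  have hJp : Function.Periodic J (2 * Real.pi) := fun s => by
    have hk : ∀ t, HasDerivAt (fun t => J (t + 2 * Real.pi) - J t) 0 t := fun t => by
      refine (((hJd (t + 2 * Real.pi)).comp_add_const t _).sub (hJd t)).congr_deriv ?_
      rw [hp, sub_self]
    have h0 := is_const_of_deriv_eq_zero (fun t => (hk t).differentiableAt)
      (fun t => (hk t).deriv) s 0
    have h1 : J (2 * Real.pi) = 0 := by
      have h2 : periodMean (fun u => f u - periodMean f) = 0 := by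
        rw [periodMean_sub hf continuous_const, periodMean_const, sub_self]
      exact (mul_eq_zero.mp h2).resolve_left (inv_ne_zero Real.two_pi_pos.ne')
    have h2 : J 0 = 0 := by simp [hJ]
    rw [zero_add, h1, h2, sub_self] at h0
    exact sub_eq_zero.mp h0
  refine ⟨fun s => J s - periodMean J, fun s => (hJd s).sub_const _, fun s => ?_, ?_⟩
  · simp only [hJp s]
  · rw [periodMean_sub hJc continuous_const, periodMean_const, sub_self]

/-- `D` is the `2π`-periodic response to the forcing `F` of the linearization of the logarithmic
equations, in which the radial part `D.re` is damped and the phase `D.im` is neutral. The mean of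
`F.im`, to which there is no periodic response, is removed, and `D.im` is normalized to have
mean zero. -/
structure IsPeriodicResponse (F D : ℝ → ℂ) : Prop where
  hasDerivAt : ∀ s, HasDerivAt D
    (⟨-2 * (D s).re + (F s).re, (F s).im - periodMean fun u => (F u).im⟩ : ℂ) s
  periodic : Function.Periodic D (2 * Real.pi)
  periodMean_im : periodMean (fun s => (D s).im) = 0

theorem IsPeriodicResponse.continuous {F D : ℝ → ℂ} (h : IsPeriodicResponse F D) : Continuous D :=
  continuous_iff_continuousAt.mpr fun s => (h.hasDerivAt s).continuousAt

theorem exists_isPeriodicResponse {F : ℝ → ℂ} (hF : Continuous F)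
    (hp : Function.Periodic F (2 * Real.pi)) : ∃ D, IsPeriodicResponse F D := by
  obtain ⟨r, hr, hrp⟩ := exists_periodic_hasDerivAt_neg_two_mul_add
    (Complex.continuous_re.comp hF) (fun s => by simp only [Function.comp_apply, hp s])
  obtain ⟨γ, hγ, hγp, hγ0⟩ := exists_periodic_hasDerivAt_sub_periodMean
    (Complex.continuous_im.comp hF) (fun s => by simp only [Function.comp_apply, hp s])
  exact ⟨fun s => ⟨r s, γ s⟩, fun s => (hr s).complex_mk (hγ s),
    fun s => by simp only [hrp s, hγp s], hγ0⟩

/-- The periodic response depends on the forcing in a Lipschitz way. -/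
theorem IsPeriodicResponse.norm_sub_le {F F' D D' : ℝ → ℂ} {A B : ℝ} (h : IsPeriodicResponse F D)
    (h' : IsPeriodicResponse F' D') (hF : Continuous F) (hF' : Continuous F')
    (hA : ∀ s, |(F s).re - (F' s).re| ≤ A) (hB : ∀ s, |(F s).im - (F' s).im| ≤ B) (s : ℝ) :
    ‖D s - D' s‖ ≤ A / 2 + 4 * Real.pi * B := by
  have hD := h.continuous
  have hD' := h'.continuous
  have h1 := abs_le_of_hasDerivAt_neg_two_mul_add (r := fun s => (D s).re - (D' s).re)
    (f := fun s => (F s).re - (F' s).re)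
    (fun s => ((h.hasDerivAt s).complex_re.sub (h'.hasDerivAt s).complex_re).congr_deriv (by
      simp only; ring)) (fun s => by simp only [h.periodic s, h'.periodic s]) hA s
  have h2 := abs_le_of_periodMean_eq_zero (r := fun s => (D s).im - (D' s).im)
    (B := 2 * B)
    (fun s => ((h.hasDerivAt s).complex_im.sub (h'.hasDerivAt s).complex_im))
    (fun s => by simp only [h.periodic s, h'.periodic s])
    (by rw [periodMean_sub (by fun_prop) (by fun_prop), h.periodMean_im, h'.periodMean_im, sub_self])
    (fun s => by
      have h3 := abs_periodMean_sub_le (Complex.continuous_im.comp hF)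
        (Complex.continuous_im.comp hF') hB
      have h4 := abs_sub ((F s).im - (F' s).im)
        ((periodMean fun u => (F u).im) - periodMean fun u => (F' u).im)
      rw [sub_sub_sub_comm]
      exact (h4.trans (add_le_add (hB s) h3)).trans (by linarith)) s
  have h3 := Complex.norm_le_abs_re_add_abs_im (D s - D' s)
  rw [Complex.sub_re, Complex.sub_im] at h3
  linarith

/-! ### The solvability conditions as equations for the phases -/

/-- The integrands of the six functionals of `(U, V)` through which the means of `Im driveA` and
`Im driveB` depend on `(U, V)`, for `V` so small that `φ (k₁ x₃) = k₁ x₃`. -/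
noncomputable def harmonicIntegrand (k₂ : ℝ) (j : Fin 6) (s : ℝ) (z w : ℂ) : ℝ :=
  ![(Complex.exp (-z - s * Complex.I)).im * Real.sin s,
    (Complex.exp (-z - s * Complex.I)).im * Real.cos s,
    (Complex.exp (-z - s * Complex.I)).im * (Complex.exp (w + s * Complex.I)).im,
    (Complex.exp (-z - s * Complex.I)).im * (Complex.exp (w + s * Complex.I)).re,
    saturation (k₂ * (Complex.exp (z + s * Complex.I)).re) *
      (Complex.exp (-w - s * Complex.I)).re,
    saturation (k₂ * (Complex.exp (z + s * Complex.I)).re) *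
      (Complex.exp (-w - s * Complex.I)).im] j

/-- The means over a period of the functions `harmonicIntegrand`. -/
noncomputable def harmonicCoeff (k₂ : ℝ) (U V : ℝ → ℂ) (j : Fin 6) : ℝ :=
  periodMean fun s => harmonicIntegrand k₂ j s (U s) (V s)

theorem continuous_harmonicIntegrand (k₂ : ℝ) (j : Fin 6) {U V : ℝ → ℂ} (hU : Continuous U)
    (hV : Continuous V) : Continuous fun s => harmonicIntegrand k₂ j s (U s) (V s) := by
  have := continuous_saturation
  fin_cases j <;> simp only [harmonicIntegrand] <;> simp <;> fun_prop

theorem abs_mul_sub_mul_le {x x' y y' X Y m n : ℝ} (hX : |x'| ≤ X) (hY : |y| ≤ Y)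
    (hm : |x - x'| ≤ m) (hn : |y - y'| ≤ n) : |x * y - x' * y'| ≤ m * Y + X * n := by
  have : x * y - x' * y' = (x - x') * y + x' * (y - y') := by ring
  rw [this]
  refine (abs_add_le _ _).trans (add_le_add ?_ ?_)
  · rw [abs_mul]
    exact mul_le_mul hm hY (abs_nonneg _) ((abs_nonneg _).trans hm)
  · rw [abs_mul]
    exact mul_le_mul hX hn (abs_nonneg _) ((abs_nonneg _).trans hX)

theorem Complex.norm_exp_add_mul_I_le {z : ℂ} (s : ℝ) (hz : ‖z‖ ≤ 1) :
    ‖Complex.exp (z + s * Complex.I)‖ ≤ 3 := by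
  have h := (abs_le.mp ((Complex.abs_re_le_norm z).trans hz)).2
  exact Complex.norm_exp_le_three (by simpa using h)

theorem abs_harmonicIntegrand_sub_le (k₂ : ℝ) (j : Fin 6) (s : ℝ) {z z' w w' : ℂ} {m : ℝ}
    (hz : ‖z‖ ≤ 1) (hz' : ‖z'‖ ≤ 1) (hw : ‖w‖ ≤ 1) (hw' : ‖w'‖ ≤ 1)
    (hzz : ‖z - z'‖ ≤ m) (hww : ‖w - w'‖ ≤ m) :
    |harmonicIntegrand k₂ j s z w - harmonicIntegrand k₂ j s z' w'| ≤ (18 + 9 * |k₂|) * m := by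
  have hm := (norm_nonneg _).trans hzz
  have hk := mul_nonneg (abs_nonneg k₂) hm
  have ez := norm_exp_neg_sub_mul_I_sub_le s s hz hz'
  have ez' := norm_exp_add_mul_I_sub_le s s hz hz'
  have ew := norm_exp_neg_sub_mul_I_sub_le s s hw hw'
  have ew' := norm_exp_add_mul_I_sub_le s s hw hw'
  rw [sub_self, abs_zero, add_zero] at ez ez' ew ew'
  replace ez := ez.trans (mul_le_mul_of_nonneg_left hzz (by norm_num))
  replace ez' := ez'.trans (mul_le_mul_of_nonneg_left hzz (by norm_num))
  replace ew := ew.trans (mul_le_mul_of_nonneg_left hww (by norm_num))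
  replace ew' := ew'.trans (mul_le_mul_of_nonneg_left hww (by norm_num))
  have bz' := Complex.norm_exp_neg_sub_mul_I_le s hz'
  have bw := Complex.norm_exp_neg_sub_mul_I_le s hw
  have cw := Complex.norm_exp_add_mul_I_le s hw
  have re_le : ∀ {a b : ℂ} {m : ℝ}, ‖a - b‖ ≤ m → |a.re - b.re| ≤ m := fun h => by
    rw [← Complex.sub_re]; exact (Complex.abs_re_le_norm _).trans h
  have im_le : ∀ {a b : ℂ} {m : ℝ}, ‖a - b‖ ≤ m → |a.im - b.im| ≤ m := fun h => by
    rw [← Complex.sub_im]; exact (Complex.abs_im_le_norm _).trans h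
  have hs := abs_saturation_mul_re_sub_le k₂ ez'
  have hs1 := abs_saturation_le_one (k₂ * (Complex.exp (z' + s * Complex.I)).re)
  fin_cases j
  · exact (abs_mul_sub_mul_le ((Complex.abs_im_le_norm _).trans bz') (Real.abs_sin_le_one s)
      (im_le ez) (by rw [sub_self, abs_zero])).trans (by linarith)
  · exact (abs_mul_sub_mul_le ((Complex.abs_im_le_norm _).trans bz') (Real.abs_cos_le_one s)
      (im_le ez) (by rw [sub_self, abs_zero])).trans (by linarith)
  · exact (abs_mul_sub_mul_le ((Complex.abs_im_le_norm _).trans bz')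
      ((Complex.abs_im_le_norm _).trans cw) (im_le ez) (im_le ew')).trans (by linarith)
  · exact (abs_mul_sub_mul_le ((Complex.abs_im_le_norm _).trans bz')
      ((Complex.abs_re_le_norm _).trans cw) (im_le ez) (re_le ew')).trans (by linarith)
  · exact (abs_mul_sub_mul_le hs1 ((Complex.abs_re_le_norm _).trans bw) hs (re_le ew)).trans
      (by linarith)
  · exact (abs_mul_sub_mul_le hs1 ((Complex.abs_im_le_norm _).trans bw) hs (im_le ew)).trans
      (by linarith)

theorem abs_harmonicCoeff_sub_le (k₂ : ℝ) {U U' V V' : ℝ → ℂ} {m : ℝ} (cU : Continuous U)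
    (cU' : Continuous U') (cV : Continuous V) (cV' : Continuous V')
    (hU : ∀ s, ‖U s‖ ≤ 1) (hU' : ∀ s, ‖U' s‖ ≤ 1) (hV : ∀ s, ‖V s‖ ≤ 1) (hV' : ∀ s, ‖V' s‖ ≤ 1)
    (hUU : ∀ s, ‖U s - U' s‖ ≤ m) (hVV : ∀ s, ‖V s - V' s‖ ≤ m) :
    dist (harmonicCoeff k₂ U V) (harmonicCoeff k₂ U' V') ≤ (18 + 9 * |k₂|) * m := by
  have hm := (norm_nonneg _).trans (hUU 0)
  exact (dist_pi_le_iff (by positivity)).mpr fun j =>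
    abs_periodMean_sub_le (continuous_harmonicIntegrand k₂ j cU cV)
      (continuous_harmonicIntegrand k₂ j cU' cV') fun s =>
      abs_harmonicIntegrand_sub_le k₂ j s (hU s) (hU' s) (hV s) (hV' s) (hUU s) (hVV s)

/-- At `U = V = 0` all coefficients vanish but those of `cos c`, `cos d` in the first condition and of
`sin d` in the second. -/
theorem harmonicCoeff_zero (k₂ : ℝ) :
    harmonicCoeff k₂ 0 0 = ![-1 / 2, 0, -1 / 2, 0, saturationCosGain k₂, 0] := by
  have h1 : ∀ s : ℝ, -0 - (s : ℂ) * Complex.I = ((-s : ℝ) : ℂ) * Complex.I := fun s => by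
    push_cast; ring
  ext j
  fin_cases j
  · have : ∀ s : ℝ, harmonicIntegrand k₂ 0 s 0 0 = -1 * (Real.sin s * Real.sin s) := fun s => by
      simp only [harmonicIntegrand, Matrix.cons_val]
      rw [h1, Complex.exp_ofReal_mul_I_im, Real.sin_neg]; ring
    simp only [Fin.zero_eta, harmonicCoeff, Pi.zero_apply, this]
    rw [periodMean_const_mul, periodMean_sin_mul_sin]
    simp; norm_num
  · have : ∀ s : ℝ, harmonicIntegrand k₂ 1 s 0 0 = -1 * (Real.sin s * Real.cos s) := fun s => by
      simp only [harmonicIntegrand, Matrix.cons_val]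
      rw [h1, Complex.exp_ofReal_mul_I_im, Real.sin_neg]; ring
    simp only [Fin.mk_one, harmonicCoeff, Pi.zero_apply, this]
    rw [periodMean_const_mul, periodMean_sin_mul_cos]
    simp
  · have : ∀ s : ℝ, harmonicIntegrand k₂ 2 s 0 0 = -1 * (Real.sin s * Real.sin s) := fun s => by
      simp only [harmonicIntegrand, Matrix.cons_val]
      rw [h1, zero_add, Complex.exp_ofReal_mul_I_im, Complex.exp_ofReal_mul_I_im, Real.sin_neg]
      ring
    simp only [Fin.reduceFinMk, harmonicCoeff, Pi.zero_apply, this]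
    rw [periodMean_const_mul, periodMean_sin_mul_sin]
    simp; norm_num
  · have : ∀ s : ℝ, harmonicIntegrand k₂ 3 s 0 0 = -1 * (Real.sin s * Real.cos s) := fun s => by
      simp only [harmonicIntegrand, Matrix.cons_val]
      rw [h1, zero_add, Complex.exp_ofReal_mul_I_im, Complex.exp_ofReal_mul_I_re, Real.sin_neg]
      ring
    simp only [Fin.reduceFinMk, harmonicCoeff, Pi.zero_apply, this]
    rw [periodMean_const_mul, periodMean_sin_mul_cos]
    simp
  · have : ∀ s : ℝ, harmonicIntegrand k₂ 4 s 0 0 = saturation (k₂ * Real.cos s) * Real.cos s :=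
      fun s => by
        simp only [harmonicIntegrand, Matrix.cons_val]
        rw [h1, zero_add, Complex.exp_ofReal_mul_I_re, Complex.exp_ofReal_mul_I_re, Real.cos_neg]
    simp only [Fin.reduceFinMk, harmonicCoeff, Pi.zero_apply, this]
    simp [saturationCosGain]
  · have : ∀ s : ℝ, harmonicIntegrand k₂ 5 s 0 0
        = -1 * (saturation (k₂ * Real.cos s) * Real.sin s) := fun s => by
      simp only [harmonicIntegrand, Matrix.cons_val]
      rw [h1, zero_add, Complex.exp_ofReal_mul_I_re, Complex.exp_ofReal_mul_I_im, Real.sin_neg]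
      ring
    simp only [Fin.reduceFinMk, harmonicCoeff, Pi.zero_apply, this]
    rw [periodMean_const_mul, periodMean_saturation_cos_mul_sin]
    simp

/-- The solvability conditions at the phases `c`, `c + d`, in terms of the coefficients
`harmonicCoeff`. -/
def PhaseEquations (k₁ : ℝ) (X : Fin 6 → ℝ) (c d : ℝ) : Prop :=
  X 0 * Real.cos c - X 1 * Real.sin c + k₁ * (X 2 * Real.cos d + X 3 * Real.sin d) = 0 ∧
    X 5 * Real.cos d - X 4 * Real.sin d = 0

theorem periodMean_im_driveA_eq (k₁ k₂ c d : ℝ) {U V : ℝ → ℂ} (hU : Continuous U)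
    (hV : Continuous V) (hk : ∀ s, |k₁| * Real.exp (V s).re ≤ 1) :
    periodMean (fun s => (driveA k₁ c d s (U s) (V s)).im)
      = harmonicCoeff k₂ U V 0 * Real.cos c - harmonicCoeff k₂ U V 1 * Real.sin c
        + k₁ * (harmonicCoeff k₂ U V 2 * Real.cos d + harmonicCoeff k₂ U V 3 * Real.sin d) := by
  have hI := fun j => continuous_harmonicIntegrand k₂ j hU hV
  have : ∀ s, (driveA k₁ c d s (U s) (V s)).im
      = Real.cos c * harmonicIntegrand k₂ 0 s (U s) (V s)
        + -Real.sin c * harmonicIntegrand k₂ 1 s (U s) (V s)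
        + k₁ * Real.cos d * harmonicIntegrand k₂ 2 s (U s) (V s)
        + k₁ * Real.sin d * harmonicIntegrand k₂ 3 s (U s) (V s) := fun s => by
    have h1 : saturation (k₁ * (Complex.exp (V s + (s + d : ℝ) * Complex.I)).im)
        = k₁ * (Complex.exp (V s + (s + d : ℝ) * Complex.I)).im := by
      refine saturation_of_abs_le ?_
      rw [abs_mul]
      refine le_trans ?_ (hk s)
      gcongr
      refine (Complex.abs_im_le_norm _).trans ?_
      rw [Complex.norm_exp]; simp
    have h2 : (Complex.exp (V s + (s + d : ℝ) * Complex.I)).im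
        = (Complex.exp (V s + s * Complex.I)).im * Real.cos d
          + (Complex.exp (V s + s * Complex.I)).re * Real.sin d := by
      rw [show V s + (s + d : ℝ) * Complex.I = V s + s * Complex.I + d * Complex.I by
        push_cast; ring, Complex.exp_add, Complex.mul_im, Complex.exp_ofReal_mul_I_im,
        Complex.exp_ofReal_mul_I_re]
      ring
    rw [driveA, Complex.im_mul_ofReal, h1, h2, Real.sin_sub]
    simp only [harmonicIntegrand, Matrix.cons_val]
    ring
  simp only [this]
  have h0 := hI 0
  have h1 := hI 1
  have h2 := hI 2
  have h3 := hI 3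
  rw [periodMean_add (by fun_prop) (by fun_prop), periodMean_add (by fun_prop) (by fun_prop),
    periodMean_add (by fun_prop) (by fun_prop),
    periodMean_const_mul, periodMean_const_mul, periodMean_const_mul, periodMean_const_mul]
  simp only [harmonicCoeff]
  ring

theorem periodMean_im_driveB_eq (k₂ d : ℝ) {U V : ℝ → ℂ} (hU : Continuous U)
    (hV : Continuous V) :
    periodMean (fun s => (driveB k₂ d s (U s) (V s)).im)
      = harmonicCoeff k₂ U V 5 * Real.cos d - harmonicCoeff k₂ U V 4 * Real.sin d := by
  have hI := fun j => continuous_harmonicIntegrand k₂ j hU hV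
  have : ∀ s, (driveB k₂ d s (U s) (V s)).im
      = Real.cos d * harmonicIntegrand k₂ 5 s (U s) (V s)
        + -Real.sin d * harmonicIntegrand k₂ 4 s (U s) (V s) := fun s => by
    have h2 : (Complex.exp (-V s - (s + d : ℝ) * Complex.I)).im
        = (Complex.exp (-V s - s * Complex.I)).im * Real.cos d
          - (Complex.exp (-V s - s * Complex.I)).re * Real.sin d := by
      rw [show -V s - (s + d : ℝ) * Complex.I
        = -V s - s * Complex.I + ((-d : ℝ) : ℂ) * Complex.I by
        push_cast; ring, Complex.exp_add, Complex.mul_im, Complex.exp_ofReal_mul_I_im,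
        Complex.exp_ofReal_mul_I_re, Real.sin_neg, Real.cos_neg]
      ring
    rw [driveB, Complex.im_mul_ofReal, h2]
    simp only [harmonicIntegrand, Matrix.cons_val]
    ring
  simp only [this]
  have h0 := hI 4
  have h1 := hI 5
  rw [periodMean_add (by fun_prop) (by fun_prop), periodMean_const_mul, periodMean_const_mul]
  simp only [harmonicCoeff]
  ring

/-- The phase difference `d` solving the second of the equations `PhaseEquations`, near the zero
`d₀` of the sine. -/
noncomputable def solvePhaseShift (d₀ : ℝ) (X : Fin 6 → ℝ) : ℝ :=
  d₀ + Real.arctan (X 5 / X 4)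

/-- After division by `-X 0`, the first of the equations `PhaseEquations` at `d = solvePhaseShift`
reads `cos (c - ψ) = solvePhaseCos`, with `ψ = arctan (X 1 / -X 0)`. -/
noncomputable def solvePhaseCos (k₁ d₀ : ℝ) (X : Fin 6 → ℝ) : ℝ :=
  k₁ * Real.cos d₀ * (X 2 * Real.cos (Real.arctan (X 5 / X 4)) +
    X 3 * Real.sin (Real.arctan (X 5 / X 4))) * Real.cos (Real.arctan (X 1 / -X 0)) / -X 0

/-- The phase `c` solving the equations `PhaseEquations`, on the branch `τ` of the inverse
cosine. -/
noncomputable def solvePhase (k₁ d₀ τ : ℝ) (X : Fin 6 → ℝ) : ℝ :=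
  Real.arctan (X 1 / -X 0) + τ * Real.arccos (solvePhaseCos k₁ d₀ X)

theorem mul_cos_sub_mul_sin_eq_zero_iff {a b x : ℝ} (ha : a ≠ 0) (hx : Real.cos x ≠ 0) :
    b * Real.cos x - a * Real.sin x = 0 ↔ Real.tan x = b / a := by
  rw [Real.tan_eq_sin_div_cos, div_eq_div_iff hx ha, sub_eq_zero, mul_comm (Real.sin x), eq_comm]

/-- The combination of `cos x` and `sin x` as a single shifted cosine; multiplying by the cosine of the
phase instead of dividing by the amplitude avoids a square root. -/
theorem mul_cos_add_mul_sin_eq_iff {A B x y : ℝ} (hA : A ≠ 0) :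
    A * Real.cos x + B * Real.sin x = y ↔
      Real.cos (x - Real.arctan (B / A)) = y * Real.cos (Real.arctan (B / A)) / A := by
  have hc := (Real.cos_arctan_pos (B / A)).ne'
  have ht : Real.sin (Real.arctan (B / A)) = B / A * Real.cos (Real.arctan (B / A)) := by
    rw [← Real.tan_mul_cos hc, Real.tan_arctan]
  rw [Real.cos_sub, ht, eq_div_iff hA]
  constructor
  · intro h; rw [← h]; field_simp
  · intro h
    have : (A * Real.cos x + B * Real.sin x) * Real.cos (Real.arctan (B / A))
        = y * Real.cos (Real.arctan (B / A)) := by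
      rw [← h]; field_simp
    exact mul_right_cancel₀ hc this

section PhaseEquations

variable {k₁ d₀ τ : ℝ} {X : Fin 6 → ℝ}

theorem phaseEquations_iff {c d : ℝ} (hd₀ : Real.sin d₀ = 0) (h4 : X 4 ≠ 0) (h0 : X 0 ≠ 0)
    (hd : |d - d₀| < Real.pi / 2) :
    PhaseEquations k₁ X c d ↔ d = solvePhaseShift d₀ X ∧
      Real.cos (c - Real.arctan (X 1 / -X 0)) = solvePhaseCos k₁ d₀ X := by
  have hcd₀ : Real.cos d₀ ≠ 0 := fun h => by
    have := Real.sin_sq_add_cos_sq d₀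
    rw [hd₀, h] at this; norm_num at this
  obtain ⟨hd1, hd2⟩ := abs_lt.mp hd
  have hcd : Real.cos (d - d₀) ≠ 0 := (Real.cos_pos_of_mem_Ioo ⟨hd1, hd2⟩).ne'
  have ec : Real.cos d = Real.cos d₀ * Real.cos (d - d₀) := by
    conv_lhs => rw [← add_sub_cancel d₀ d, Real.cos_add, hd₀]
    ring
  have es : Real.sin d = Real.cos d₀ * Real.sin (d - d₀) := by
    conv_lhs => rw [← add_sub_cancel d₀ d, Real.sin_add, hd₀]
    ring
  have e2 : X 5 * Real.cos d - X 4 * Real.sin d = 0 ↔ d = solvePhaseShift d₀ X := by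
    rw [ec, es, show X 5 * (Real.cos d₀ * Real.cos (d - d₀)) - X 4 * (Real.cos d₀ * Real.sin (d - d₀))
      = Real.cos d₀ * (X 5 * Real.cos (d - d₀) - X 4 * Real.sin (d - d₀)) by ring, mul_eq_zero,
      or_iff_right hcd₀, mul_cos_sub_mul_sin_eq_zero_iff h4 hcd, solvePhaseShift, ← sub_eq_iff_eq_add']
    constructor
    · intro h; rw [← h, Real.arctan_tan hd1 hd2]
    · intro h; rw [h, Real.tan_arctan]
  rw [PhaseEquations, and_comm, e2]
  refine and_congr_right fun h => ?_
  have hdd : d - d₀ = Real.arctan (X 5 / X 4) := by rw [h, solvePhaseShift, add_sub_cancel_left]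
  rw [solvePhaseCos, ← mul_cos_add_mul_sin_eq_iff (neg_ne_zero.mpr h0), ec, es, hdd]
  constructor <;> intro h <;> linarith

theorem phaseEquations_solvePhase (hd₀ : Real.sin d₀ = 0) (hτ : τ = 1 ∨ τ = -1) (h4 : X 4 ≠ 0)
    (h0 : X 0 ≠ 0) (h1 : |solvePhaseCos k₁ d₀ X| < 1) :
    PhaseEquations k₁ X (solvePhase k₁ d₀ τ X) (solvePhaseShift d₀ X) := by
  have hd : |solvePhaseShift d₀ X - d₀| < Real.pi / 2 := by
    rw [solvePhaseShift, add_sub_cancel_left, abs_lt]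
    exact ⟨Real.neg_pi_div_two_lt_arctan _, Real.arctan_lt_pi_div_two _⟩
  rw [phaseEquations_iff hd₀ h4 h0 hd]
  refine ⟨rfl, ?_⟩
  obtain ⟨h2, h3⟩ := abs_lt.mp h1
  rw [solvePhase, add_sub_cancel_left]
  rcases hτ with rfl | rfl
  · rw [one_mul, Real.cos_arccos h2.le h3.le]
  · rw [neg_one_mul, Real.cos_neg, Real.cos_arccos h2.le h3.le]

/-- The two inequalities place `c` on the branch of the inverse cosine selected by `τ`. -/
theorem PhaseEquations.eq_solvePhase {c d : ℝ} (h : PhaseEquations k₁ X c d)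
    (hd₀ : Real.sin d₀ = 0) (hτ : τ = 1 ∨ τ = -1) (h4 : X 4 ≠ 0)
    (h0 : X 0 ≠ 0) (hd : |d - d₀| < Real.pi / 2)
    (hc0 : 0 ≤ τ * (c - Real.arctan (X 1 / -X 0)))
    (hcpi : τ * (c - Real.arctan (X 1 / -X 0)) ≤ Real.pi) :
    c = solvePhase k₁ d₀ τ X ∧ d = solvePhaseShift d₀ X := by
  obtain ⟨h1, h2⟩ := (phaseEquations_iff hd₀ h4 h0 hd).mp h
  refine ⟨?_, h1⟩
  rw [solvePhase, ← h2]
  rcases hτ with rfl | rfl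
  · rw [one_mul] at hc0 hcpi ⊢
    rw [Real.arccos_cos hc0 hcpi]; ring
  · rw [← Real.cos_neg, Real.arccos_cos (by linarith) (by linarith)]; ring

theorem contDiffAt_solvePhaseShift (h4 : X 4 ≠ 0) : ContDiffAt ℝ 1 (solvePhaseShift d₀) X := by
  unfold solvePhaseShift
  have hp : ∀ i : Fin 6, ContDiffAt ℝ 1 (fun X : Fin 6 → ℝ => X i) X := fun i =>
    contDiffAt_apply ℝ ℝ i X
  exact contDiffAt_const.add ((hp 5).div (hp 4) h4).arctan

theorem contDiffAt_solvePhaseCos (h4 : X 4 ≠ 0) (h0 : X 0 ≠ 0) :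
    ContDiffAt ℝ 1 (solvePhaseCos k₁ d₀) X := by
  unfold solvePhaseCos
  have hp : ∀ i : Fin 6, ContDiffAt ℝ 1 (fun X : Fin 6 → ℝ => X i) X := fun i =>
    contDiffAt_apply ℝ ℝ i X
  have h54 := ((hp 5).div (hp 4) h4).arctan
  have h10 := ((hp 1).div (hp 0).neg (neg_ne_zero.mpr h0)).arctan
  exact (((contDiffAt_const.mul contDiffAt_const).mul
    (((hp 2).mul h54.cos).add ((hp 3).mul h54.sin))).mul h10.cos).div (hp 0).neg
      (neg_ne_zero.mpr h0)

theorem contDiffAt_solvePhase (h4 : X 4 ≠ 0) (h0 : X 0 ≠ 0) (h1 : |solvePhaseCos k₁ d₀ X| < 1) :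
    ContDiffAt ℝ 1 (solvePhase k₁ d₀ τ) X := by
  unfold solvePhase
  have hp : ∀ i : Fin 6, ContDiffAt ℝ 1 (fun X : Fin 6 → ℝ => X i) X := fun i =>
    contDiffAt_apply ℝ ℝ i X
  obtain ⟨h2, h3⟩ := abs_lt.mp h1
  exact ((hp 1).div (hp 0).neg (neg_ne_zero.mpr h0)).arctan.add (contDiffAt_const.mul
    ((Real.contDiffAt_arccos h2.ne' h3.ne).comp X (contDiffAt_solvePhaseCos h4 h0)))

end PhaseEquations

/-! ### The phases as functionals of the logarithmic coordinates -/

/-- Near the coefficients at `U = V = 0`, the phase equations have exactly one solution near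
`(τ arccos (-(k₁ cos d₀)), d₀)`, and it is a Lipschitz function of the coefficients. -/
theorem exists_phase_branch {k₁ k₂ d₀ τ : ℝ} (hk₁ : |k₁| < 1) (hk₂ : k₂ ≠ 0)
    (hd₀ : Real.sin d₀ = 0) (hτ : τ = 1 ∨ τ = -1) :
    ∃ r > 0, ∃ K : ℝ, 0 ≤ K ∧ ∃ C D : (Fin 6 → ℝ) → ℝ,
      C (harmonicCoeff k₂ 0 0) = τ * Real.arccos (-(k₁ * Real.cos d₀)) ∧
      D (harmonicCoeff k₂ 0 0) = d₀ ∧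
      ∀ X, dist X (harmonicCoeff k₂ 0 0) < r →
        PhaseEquations k₁ X (C X) (D X) ∧
        (∀ X', dist X' (harmonicCoeff k₂ 0 0) < r →
          |C X - C X'| ≤ K * dist X X' ∧ |D X - D X'| ≤ K * dist X X') ∧
        ∀ c d, |c - τ * Real.arccos (-(k₁ * Real.cos d₀))| < r → |d - d₀| < r →
          PhaseEquations k₁ X c d → c = C X ∧ d = D X := by
  set X₀ := harmonicCoeff k₂ 0 0 with hX₀
  have e0 : X₀ 0 = -1 / 2 := by rw [hX₀, harmonicCoeff_zero]; rfl
  have e1 : X₀ 1 = 0 := by rw [hX₀, harmonicCoeff_zero]; rfl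
  have e2 : X₀ 2 = -1 / 2 := by rw [hX₀, harmonicCoeff_zero]; rfl
  have e4 : X₀ 4 = saturationCosGain k₂ := by rw [hX₀, harmonicCoeff_zero]; rfl
  have e5 : X₀ 5 = 0 := by rw [hX₀, harmonicCoeff_zero]; rfl
  have h4 : X₀ 4 ≠ 0 := e4 ▸ saturationCosGain_ne_zero hk₂
  have h0 : X₀ 0 ≠ 0 := by rw [e0]; norm_num
  have hcos : solvePhaseCos k₁ d₀ X₀ = -(k₁ * Real.cos d₀) := by
    rw [solvePhaseCos, e0, e1, e2, e5]
    simp only [zero_div, Real.arctan_zero, Real.cos_zero, Real.sin_zero]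
    ring
  have h1 : |solvePhaseCos k₁ d₀ X₀| < 1 := by
    rw [hcos, abs_neg, abs_mul]
    exact (mul_le_of_le_one_right (abs_nonneg _) (Real.abs_cos_le_one _)).trans_lt hk₁
  set c₀ := τ * Real.arccos (-(k₁ * Real.cos d₀)) with hc₀
  have hC₀ : solvePhase k₁ d₀ τ X₀ = c₀ := by
    rw [solvePhase, hcos, e1]; simp [hc₀]
  obtain ⟨K₁, t₁, ht₁, hL₁⟩ := (contDiffAt_solvePhase (τ := τ) h4 h0 h1).exists_lipschitzOnWith
  obtain ⟨K₂, t₂, ht₂, hL₂⟩ := (contDiffAt_solvePhaseShift (d₀ := d₀) h4).exists_lipschitzOnWith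
  have n4 : ∀ᶠ X in 𝓝 X₀, X 4 ≠ 0 := (continuous_apply 4).continuousAt.eventually_ne h4
  have n0 : ∀ᶠ X in 𝓝 X₀, X 0 ≠ 0 := (continuous_apply 0).continuousAt.eventually_ne h0
  have n1 : ∀ᶠ X in 𝓝 X₀, |solvePhaseCos k₁ d₀ X| < 1 :=
    (contDiffAt_solvePhaseCos h4 h0).continuousAt.abs.eventually (gt_mem_nhds h1)
  -- `τ (c - ψ)` is near `arccos (-(k₁ cos d₀))`, which lies strictly between `0` and `π`.
  have hτ2 : τ * c₀ = Real.arccos (-(k₁ * Real.cos d₀)) := by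
    rcases hτ with h | h <;> rw [hc₀, h] <;> ring
  obtain ⟨ha, hb⟩ := abs_lt.mp (hcos ▸ h1)
  have hpos : 0 < τ * c₀ := hτ2 ▸ Real.arccos_pos.mpr hb
  have hlt : τ * c₀ < Real.pi := by
    rw [hτ2]
    refine lt_of_le_of_ne (Real.arccos_le_pi _) fun h => ?_
    have := Real.arccos_eq_pi.mp h
    linarith
  have hcont : ContinuousAt (fun q : (Fin 6 → ℝ) × ℝ => τ * (q.2 - Real.arctan (q.1 1 / -q.1 0)))
      (X₀, c₀) := by
    have hp : ∀ i : Fin 6, ContinuousAt (fun q : (Fin 6 → ℝ) × ℝ => q.1 i) (X₀, c₀) := fun i =>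
      ((continuous_apply i).comp continuous_fst).continuousAt
    exact continuousAt_const.mul (continuousAt_snd.sub (Real.continuous_arctan.continuousAt.comp
      ((hp 1).div (hp 0).neg (neg_ne_zero.mpr h0))))
  have hval : τ * (c₀ - Real.arctan (X₀ 1 / -X₀ 0)) = τ * c₀ := by rw [e1]; simp
  have n2 : ∀ᶠ q : (Fin 6 → ℝ) × ℝ in 𝓝 (X₀, c₀),
      τ * (q.2 - Real.arctan (q.1 1 / -q.1 0)) ∈ Set.Ioo 0 Real.pi :=
    hcont.eventually (Ioo_mem_nhds (by simpa only [hval] using hpos) (by simpa only [hval] using hlt))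
  rw [nhds_prod_eq] at n2
  obtain ⟨P, hP, Q, hQ, hPQ⟩ := eventually_prod_iff.mp n2
  obtain ⟨r₁, hr₁, H₁⟩ := Metric.eventually_nhds_iff.mp
    ((((n4.and n0).and n1).and (Filter.eventually_of_mem ht₁ fun _ h => h)).and
      ((Filter.eventually_of_mem ht₂ fun _ h => h).and hP))
  obtain ⟨r₂, hr₂, H₂⟩ := Metric.eventually_nhds_iff.mp hQ
  refine ⟨min r₁ (min r₂ (Real.pi / 2)), by positivity, max K₁ K₂, by positivity,
    solvePhase k₁ d₀ τ, solvePhaseShift d₀, hC₀, ?_, fun X hX => ?_⟩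
  · rw [solvePhaseShift, e5]; simp
  obtain ⟨⟨⟨⟨g4, g0⟩, g1⟩, gt₁⟩, gt₂, gP⟩ := H₁ (hX.trans_le (min_le_left _ _))
  refine ⟨phaseEquations_solvePhase hd₀ hτ g4 g0 g1, fun X' hX' => ?_, fun c d hc hd h => ?_⟩
  · obtain ⟨⟨⟨⟨g4', g0'⟩, g1'⟩, gt₁'⟩, gt₂', gP'⟩ := H₁ (hX'.trans_le (min_le_left _ _))
    exact ⟨(hL₁.dist_le_mul X gt₁ X' gt₁').trans (by gcongr; exact le_max_left _ _),
      (hL₂.dist_le_mul X gt₂ X' gt₂').trans (by gcongr; exact le_max_right _ _)⟩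
  · obtain ⟨g5, g6⟩ := hPQ gP
      (H₂ (hc.trans_le ((min_le_right _ _).trans (min_le_left _ _))))
    exact h.eq_solvePhase hd₀ hτ g4 g0
      (hd.trans_le ((min_le_right _ _).trans (min_le_right _ _))) g5.le g6.le

/-- For small `U`, `V` the phases `c`, `d` are determined by the solvability conditions, as
Lipschitz functionals of `(U, V)`. -/
theorem exists_phase_functional {k₁ k₂ d₀ τ : ℝ} (hk₁ : |k₁| < 1) (hk₂ : k₂ ≠ 0)
    (hd₀ : Real.sin d₀ = 0) (hτ : τ = 1 ∨ τ = -1) :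
    ∃ ρ : ℝ, 0 < ρ ∧ ρ ≤ 1 / 16 ∧ ∃ K : ℝ, 0 ≤ K ∧ ∃ C D : (ℝ → ℂ) → (ℝ → ℂ) → ℝ,
      C 0 0 = τ * Real.arccos (-(k₁ * Real.cos d₀)) ∧ D 0 0 = d₀ ∧
      ∀ U V, Continuous U → Continuous V → (∀ s, ‖U s‖ ≤ ρ) → (∀ s, ‖V s‖ ≤ ρ) →
        periodMean (fun s => (driveA k₁ (C U V) (D U V) s (U s) (V s)).im) = 0 ∧
        periodMean (fun s => (driveB k₂ (D U V) s (U s) (V s)).im) = 0 ∧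
        (∀ U' V' m, Continuous U' → Continuous V' → (∀ s, ‖U' s‖ ≤ ρ) → (∀ s, ‖V' s‖ ≤ ρ) →
          (∀ s, ‖U s - U' s‖ ≤ m) → (∀ s, ‖V s - V' s‖ ≤ m) →
          |C U V - C U' V'| ≤ K * m ∧ |D U V - D U' V'| ≤ K * m) ∧
        ∀ c d, |c - τ * Real.arccos (-(k₁ * Real.cos d₀))| ≤ ρ → |d - d₀| ≤ ρ →
          periodMean (fun s => (driveA k₁ c d s (U s) (V s)).im) = 0 →
          periodMean (fun s => (driveB k₂ d s (U s) (V s)).im) = 0 → c = C U V ∧ d = D U V := by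
  obtain ⟨r, hr, K, hK, C, D, hC, hD, H⟩ := exists_phase_branch hk₁ hk₂ hd₀ hτ
  set N : ℝ := 18 + 9 * |k₂| with hN
  have hN0 : 0 < N := by positivity
  have hexp : ∀ᶠ ρ in 𝓝[>] (0 : ℝ), |k₁| * Real.exp ρ ≤ 1 := by
    have : ContinuousAt (fun ρ => |k₁| * Real.exp ρ) 0 := by fun_prop
    refine (this.eventually (ge_mem_nhds ?_)).filter_mono nhdsWithin_le_nhds
    simpa using hk₁
  have hsmall : ∀ᶠ ρ in 𝓝[>] (0 : ℝ), ρ < min (min r (r / N)) (1 / 16) :=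
    (gt_mem_nhds (by positivity)).filter_mono nhdsWithin_le_nhds
  obtain ⟨ρ, ⟨h1, h2⟩, h3⟩ := ((hexp.and hsmall).and self_mem_nhdsWithin).exists
  replace h3 : 0 < ρ := h3
  have hρr : ρ < r := h2.trans_le ((min_le_left _ _).trans (min_le_left _ _))
  have hρN : N * ρ < r := by
    have := h2.trans_le ((min_le_left _ _).trans (min_le_right _ _))
    rwa [lt_div_iff₀ hN0, mul_comm] at this
  have hρ16 : ρ ≤ 1 / 16 := h2.le.trans (min_le_right _ _)
  have hball : ∀ U V, Continuous U → Continuous V → (∀ s, ‖U s‖ ≤ ρ) → (∀ s, ‖V s‖ ≤ ρ) →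
      dist (harmonicCoeff k₂ U V) (harmonicCoeff k₂ 0 0) < r := fun U V cU cV hU hV =>
    (abs_harmonicCoeff_sub_le k₂ (U' := 0) (V' := 0) (m := ρ) cU continuous_zero cV continuous_zero
      (fun s => (hU s).trans (by linarith)) (by simp) (fun s => (hV s).trans (by linarith))
      (by simp) (by simpa using hU) (by simpa using hV)).trans_lt hρN
  have hlin : ∀ V : ℝ → ℂ, (∀ s, ‖V s‖ ≤ ρ) → ∀ s, |k₁| * Real.exp (V s).re ≤ 1 := fun V hV s => by
    refine le_trans ?_ h1
    gcongr
    exact (Complex.re_le_norm _).trans (hV s)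
  refine ⟨ρ, h3, hρ16, K * N, by positivity, fun U V => C (harmonicCoeff k₂ U V),
    fun U V => D (harmonicCoeff k₂ U V), hC, hD, fun U V cU cV hU hV => ?_⟩
  obtain ⟨H1, H2, H3⟩ := H _ (hball U V cU cV hU hV)
  refine ⟨?_, ?_, fun U' V' m cU' cV' hU' hV' hUU hVV => ?_, fun c d hc hd hA hB => ?_⟩
  · rw [periodMean_im_driveA_eq k₁ k₂ _ _ cU cV (hlin V hV)]; exact H1.1
  · rw [periodMean_im_driveB_eq k₂ _ cU cV]; exact H1.2
  · have hle := abs_harmonicCoeff_sub_le k₂ cU cU' cV cV'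
      (fun s => (hU s).trans (by linarith)) (fun s => (hU' s).trans (by linarith))
      (fun s => (hV s).trans (by linarith)) (fun s => (hV' s).trans (by linarith)) hUU hVV
    obtain ⟨H4, H5⟩ := H2 _ (hball U' V' cU' cV' hU' hV')
    rw [mul_assoc]
    exact ⟨H4.trans (by gcongr), H5.trans (by gcongr)⟩
  · rw [periodMean_im_driveA_eq k₁ k₂ _ _ cU cV (hlin V hV)] at hA
    rw [periodMean_im_driveB_eq k₂ _ cU cV] at hB
    exact H3 c d (hc.trans_lt hρr) (hd.trans_lt hρr) ⟨hA, hB⟩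

/-- The right-hand side of a logarithmic equation with forcing `ε f`, without the linear damping
`-2 U.re`. -/
noncomputable def logForcing (ε : ℝ) (U f : ℝ → ℂ) (s : ℝ) : ℂ :=
  ((2 * (U s).re + 1 - Real.exp (2 * (U s).re) : ℝ) : ℂ) + ε * f s

theorem continuous_logForcing (ε : ℝ) {U f : ℝ → ℂ} (hU : Continuous U) (hf : Continuous f) :
    Continuous (logForcing ε U f) := by
  unfold logForcing; fun_prop

theorem logForcing_re (ε : ℝ) (U f : ℝ → ℂ) (s : ℝ) :
    (logForcing ε U f s).re = 2 * (U s).re + 1 - Real.exp (2 * (U s).re) + ε * (f s).re := by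
  simp [logForcing, -Complex.ofReal_sub, -Complex.ofReal_add]

theorem logForcing_im (ε : ℝ) (U f : ℝ → ℂ) (s : ℝ) :
    (logForcing ε U f s).im = ε * (f s).im := by
  simp [logForcing, -Complex.ofReal_sub, -Complex.ofReal_add]

/-- Under the solvability condition, the normalized periodic solutions of a logarithmic equation are the
fixed points of the passage from `U` to the periodic response to `logForcing ε U f`. -/
theorem isPeriodicResponse_logForcing_iff {ε : ℝ} {U f : ℝ → ℂ}
    (hf : periodMean (fun s => (f s).im) = 0) :
    IsPeriodicResponse (logForcing ε U f) U ↔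
      (∀ s, HasDerivAt U (((1 - Real.exp (2 * (U s).re) : ℝ) : ℂ) + ε * f s) s) ∧
        Function.Periodic U (2 * Real.pi) ∧ periodMean (fun s => (U s).im) = 0 := by
  have h0 : (periodMean fun u => (logForcing ε U f u).im) = 0 := by
    simp only [logForcing_im]
    rw [periodMean_const_mul, hf, mul_zero]
  have h1 : ∀ s, (⟨-2 * (U s).re + (logForcing ε U f s).re, (logForcing ε U f s).im -
      periodMean fun u => (logForcing ε U f u).im⟩ : ℂ)
      = ((1 - Real.exp (2 * (U s).re) : ℝ) : ℂ) + ε * f s := fun s => by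
    rw [h0, logForcing_re, logForcing_im]
    apply Complex.ext
    · simp [-Complex.ofReal_sub]
      ring
    · simp [-Complex.ofReal_sub]
  constructor
  · intro h
    exact ⟨fun s => (h.hasDerivAt s).congr_deriv (h1 s), h.periodic, h.periodMean_im⟩
  · rintro ⟨h2, h3, h4⟩
    exact ⟨fun s => (h2 s).congr_deriv (h1 s).symm, h3, h4⟩

/-- The nonlinear remainder of the damping is quadratic, so its Lipschitz constant on a small ball is of
the order of the radius. -/
theorem abs_two_mul_sub_exp_sub_le {x y ρ : ℝ} (hρ : ρ ≤ 1 / 2) (hx : |x| ≤ ρ) (hy : |y| ≤ ρ) :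
    |(2 * x + 1 - Real.exp (2 * x)) - (2 * y + 1 - Real.exp (2 * y))| ≤ 8 * ρ * |x - y| := by
  have hd : ∀ u : ℝ, HasDerivAt (fun u => 2 * u + 1 - Real.exp (2 * u))
      (2 - 2 * Real.exp (2 * u)) u := fun u => by
    have h1 := (hasDerivAt_id u).const_mul 2
    refine ((h1.add_const 1).sub h1.exp).congr_deriv ?_
    simp only [id]; ring
  refine Convex.norm_image_sub_le_of_norm_hasDerivWithin_le (s := Set.Icc (-ρ) ρ)
    (fun u _ => (hd u).hasDerivWithinAt) (fun u hu => ?_) (convex_Icc _ _) (abs_le.mp hy)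
    (abs_le.mp hx)
  have hu' : |u| ≤ ρ := abs_le.mpr hu
  have h2 : |2 * u| = 2 * |u| := by rw [abs_mul, abs_two]
  have := Real.abs_exp_sub_one_le (x := 2 * u) (by rw [h2]; linarith)
  rw [Real.norm_eq_abs, show 2 - 2 * Real.exp (2 * u) = -(2 * (Real.exp (2 * u) - 1)) by ring,
    abs_neg, abs_mul, abs_two]
  linarith

theorem norm_sub_le_of_isPeriodicResponse_logForcing {ε ρ m n : ℝ} {U U' f f' D D' : ℝ → ℂ}
    (hε : 0 ≤ ε) (hρ : ρ ≤ 1 / 16)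
    (cU : Continuous U) (cU' : Continuous U') (cf : Continuous f) (cf' : Continuous f')
    (h : IsPeriodicResponse (logForcing ε U f) D) (h' : IsPeriodicResponse (logForcing ε U' f') D')
    (hU : ∀ s, ‖U s‖ ≤ ρ) (hU' : ∀ s, ‖U' s‖ ≤ ρ) (hUU : ∀ s, ‖U s - U' s‖ ≤ m)
    (hff : ∀ s, ‖f s - f' s‖ ≤ n) (s : ℝ) : ‖D s - D' s‖ ≤ m / 4 + 17 * ε * n := by
  have hρ0 := (norm_nonneg _).trans (hU 0)
  have hm0 := (norm_nonneg _).trans (hUU 0)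
  have hn0 := (norm_nonneg _).trans (hff 0)
  have key := h.norm_sub_le h' (continuous_logForcing ε cU cf) (continuous_logForcing ε cU' cf')
    (A := m / 2 + ε * n) (B := ε * n) (fun s => by
      rw [logForcing_re, logForcing_re, add_sub_add_comm, ← mul_sub]
      refine (abs_add_le _ _).trans (add_le_add ?_ ?_)
      · refine (abs_two_mul_sub_exp_sub_le (by linarith) ((Complex.abs_re_le_norm _).trans (hU s))
          ((Complex.abs_re_le_norm _).trans (hU' s))).trans ?_
        rw [← Complex.sub_re]
        have := (Complex.abs_re_le_norm _).trans (hUU s)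
        calc 8 * ρ * |(U s - U' s).re| ≤ 8 * (1 / 16) * m := by gcongr
          _ = m / 2 := by ring
      · rw [abs_mul, abs_of_nonneg hε, ← Complex.sub_re]
        exact mul_le_mul_of_nonneg_left ((Complex.abs_re_le_norm _).trans (hff s)) hε)
    (fun s => by
      rw [logForcing_im, logForcing_im, ← mul_sub, abs_mul, abs_of_nonneg hε, ← Complex.sub_im]
      exact mul_le_mul_of_nonneg_left ((Complex.abs_im_le_norm _).trans (hff s)) hε) s
  have hpi := Real.pi_le_four
  have : 4 * Real.pi * (ε * n) ≤ 16 * (ε * n) := by gcongr; linarith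
  have := mul_nonneg hε hn0
  linarith

theorem norm_le_of_isPeriodicResponse_logForcing_zero {ε n : ℝ} {f D : ℝ → ℂ}
    (hε : 0 ≤ ε) (cf : Continuous f) (h : IsPeriodicResponse (logForcing ε 0 f) D)
    (hf : ∀ s, ‖f s‖ ≤ n) (s : ℝ) : ‖D s‖ ≤ 17 * ε * n := by
  have h0 : IsPeriodicResponse (logForcing ε 0 0) 0 := by
    rw [isPeriodicResponse_logForcing_iff (by simp [periodMean])]
    refine ⟨fun s => ?_, fun s => rfl, by simp [periodMean]⟩
    simp [hasDerivAt_zero]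
  have := norm_sub_le_of_isPeriodicResponse_logForcing (ρ := 0) (m := 0) (n := n) hε (by norm_num)
    continuous_zero continuous_zero cf continuous_zero h h0 (by simp) (by simp) (by simp)
    (by simpa using hf) s
  simpa using this

/-! ### The contraction -/

instance fact_two_pi_pos : Fact (0 < 2 * Real.pi) := ⟨Real.two_pi_pos⟩

/-- The continuous function on the circle induced by a continuous `2π`-periodic function. -/
noncomputable def circleLift (f : ℝ → ℂ) (hf : Continuous f)
    (hp : Function.Periodic f (2 * Real.pi)) : C(AddCircle (2 * Real.pi), ℂ) :=
  ⟨hp.lift, hf.quotient_lift _⟩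

theorem continuous_circle_coe (w : C(AddCircle (2 * Real.pi), ℂ)) :
    Continuous fun s : ℝ => w s :=
  w.continuous.comp (AddCircle.continuous_mk' _)

theorem periodic_circle_coe (w : C(AddCircle (2 * Real.pi), ℂ)) :
    Function.Periodic (fun s : ℝ => w s) (2 * Real.pi) := fun s => by
  simp only [AddCircle.coe_add_period]

theorem norm_circle_le {w : C(AddCircle (2 * Real.pi), ℂ)} {m : ℝ} (hm : 0 ≤ m)
    (h : ∀ s : ℝ, ‖w s‖ ≤ m) : ‖w‖ ≤ m := by
  refine (ContinuousMap.norm_le _ hm).mpr fun x => ?_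
  induction x using QuotientAddGroup.induction_on with
  | H s => exact h s

theorem logForcing_periodic {ε : ℝ} {U f : ℝ → ℂ} (hU : Function.Periodic U (2 * Real.pi))
    (hf : Function.Periodic f (2 * Real.pi)) :
    Function.Periodic (logForcing ε U f) (2 * Real.pi) := fun s => by
  simp only [logForcing, hU s, hf s]

/-- Pairs of functions coincide if every bound on their distance can be halved. -/
theorem eq_of_forall_norm_sub_le_half {U U' V V' : ℝ → ℂ} {m₀ : ℝ}
    (hU : ∀ s, ‖U s - U' s‖ ≤ m₀) (hV : ∀ s, ‖V s - V' s‖ ≤ m₀)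
    (h : ∀ m, (∀ s, ‖U s - U' s‖ ≤ m) → (∀ s, ‖V s - V' s‖ ≤ m) →
      (∀ s, ‖U s - U' s‖ ≤ m / 2) ∧ ∀ s, ‖V s - V' s‖ ≤ m / 2) : U = U' ∧ V = V' := by
  have key : ∀ n : ℕ, (∀ s, ‖U s - U' s‖ ≤ m₀ / 2 ^ n) ∧ ∀ s, ‖V s - V' s‖ ≤ m₀ / 2 ^ n := by
    intro n
    induction n with
    | zero => simpa using ⟨hU, hV⟩
    | succ n ih => rw [pow_succ, ← div_div]; exact h _ ih.1 ih.2
  have hlim : Tendsto (fun n : ℕ => m₀ / 2 ^ n) atTop (𝓝 0) :=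
    tendsto_const_nhds.div_atTop (tendsto_pow_atTop_atTop_of_one_lt one_lt_two)
  exact ⟨funext fun s => sub_eq_zero.mp (norm_le_zero_iff.mp
      (ge_of_tendsto hlim (Eventually.of_forall fun n => (key n).1 s))),
    funext fun s => sub_eq_zero.mp (norm_le_zero_iff.mp
      (ge_of_tendsto hlim (Eventually.of_forall fun n => (key n).2 s)))⟩

/-- Near the phases `c₀`, `d₀` there is, for small `ε`, exactly one normalized small periodic
solution of the logarithmic equations: it is the fixed point of a contraction. -/
theorem exists_unique_normalized_isPhaseSolution {k₁ k₂ d₀ τ : ℝ} (hk₁ : |k₁| < 1) (hk₂ : k₂ ≠ 0)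
    (hd₀ : Real.sin d₀ = 0) (hτ : τ = 1 ∨ τ = -1) :
    ∃ ρ > 0, ∃ M > 0, ∃ ε₁ > 0, ∀ ε, 0 < ε → ε ≤ ε₁ →
      (∃ U V c d, IsPhaseSolution k₁ k₂ ε c d U V ∧ (∀ s, ‖U s‖ ≤ M * ε) ∧
        (∀ s, ‖V s‖ ≤ M * ε) ∧ |c - τ * Real.arccos (-(k₁ * Real.cos d₀))| ≤ M * ε ∧
        |d - d₀| ≤ M * ε) ∧
      ∀ U V c d U' V' c' d', IsPhaseSolution k₁ k₂ ε c d U V → IsPhaseSolution k₁ k₂ ε c' d' U' V' →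
        periodMean (fun s => (U s).im) = 0 → periodMean (fun s => (V s).im) = 0 →
        periodMean (fun s => (U' s).im) = 0 → periodMean (fun s => (V' s).im) = 0 →
        (∀ s, ‖U s‖ ≤ ρ) → (∀ s, ‖V s‖ ≤ ρ) → (∀ s, ‖U' s‖ ≤ ρ) → (∀ s, ‖V' s‖ ≤ ρ) →
        |c - τ * Real.arccos (-(k₁ * Real.cos d₀))| ≤ ρ → |d - d₀| ≤ ρ →
        |c' - τ * Real.arccos (-(k₁ * Real.cos d₀))| ≤ ρ → |d' - d₀| ≤ ρ →
        U = U' ∧ V = V' ∧ c = c' ∧ d = d' := by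
  obtain ⟨ρ, hρ, hρ16, K, hK, C, D, hC0, hD0, H⟩ := exists_phase_functional hk₁ hk₂ hd₀ hτ
  set L : ℝ := 9 * (2 + |k₁| + |k₂|) * (1 + K) with hL
  have hL0 : 0 < L := by positivity
  set ε₁ : ℝ := min (1 / (68 * L)) (ρ / 204) with hε₁
  set M : ℝ := 204 * (1 + K) with hM
  -- The difference of the two responses is at most half the difference of the arguments.
  have step : ∀ ε, 0 < ε → ε ≤ ε₁ → ∀ U V U' V' E F E' F' : ℝ → ℂ, ∀ m, Continuous U →
      Continuous V → Continuous U' → Continuous V' → (∀ s, ‖U s‖ ≤ ρ) → (∀ s, ‖V s‖ ≤ ρ) →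
      (∀ s, ‖U' s‖ ≤ ρ) → (∀ s, ‖V' s‖ ≤ ρ) → (∀ s, ‖U s - U' s‖ ≤ m) →
      (∀ s, ‖V s - V' s‖ ≤ m) →
      IsPeriodicResponse
        (logForcing ε U fun s => driveA k₁ (C U V) (D U V) s (U s) (V s)) E →
      IsPeriodicResponse (logForcing ε V fun s => driveB k₂ (D U V) s (U s) (V s)) F →
      IsPeriodicResponse
        (logForcing ε U' fun s => driveA k₁ (C U' V') (D U' V') s (U' s) (V' s)) E' →
      IsPeriodicResponse (logForcing ε V' fun s => driveB k₂ (D U' V') s (U' s) (V' s)) F' →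
      (∀ s, ‖E s - E' s‖ ≤ m / 2) ∧ ∀ s, ‖F s - F' s‖ ≤ m / 2 := by
    intro ε hε hεε U V U' V' E F E' F' m cU cV cU' cV' hU hV hU' hV' hUU hVV rE rF rE' rF'
    obtain ⟨hc, hd⟩ := (H U V cU cV hU hV).2.2.1 U' V' m cU' cV' hU' hV' hUU hVV
    have hm := (norm_nonneg _).trans (hUU 0)
    have hεL : 17 * ε * (L * m) ≤ m / 4 := by
      have : ε ≤ 1 / (68 * L) := hεε.trans (min_le_left _ _)
      rw [le_div_iff₀ (by positivity)] at this
      have := mul_le_mul_of_nonneg_right this hm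
      linarith
    have h1 : ∀ {z : ℂ}, ‖z‖ ≤ ρ → ‖z‖ ≤ 1 := fun h => h.trans (by linarith)
    have ek₁ := abs_nonneg k₁
    have ek₂ := abs_nonneg k₂
    have hKm : 0 ≤ m + K * m := by positivity
    constructor
    · intro s
      refine (norm_sub_le_of_isPeriodicResponse_logForcing hε.le hρ16 cU cU'
        (continuous_driveA _ _ _ cU cV) (continuous_driveA _ _ _ cU' cV') rE rE' hU hU' hUU
        (n := L * m) (fun s => (norm_driveA_sub_le k₁ s (h1 (hU s)) (h1 (hU' s)) (h1 (hV s))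
          (h1 (hV' s)) (hUU s) (hVV s) hc hd).trans ?_) s).trans (by linarith)
      have : 9 * (1 + |k₁|) * (m + K * m) ≤ 9 * (2 + |k₁| + |k₂|) * (m + K * m) :=
        mul_le_mul_of_nonneg_right (by linarith) hKm
      refine this.trans (le_of_eq ?_)
      rw [hL]; ring
    · intro s
      refine (norm_sub_le_of_isPeriodicResponse_logForcing hε.le hρ16 cV cV'
        (continuous_driveB _ _ cU cV) (continuous_driveB _ _ cU' cV') rF rF' hV hV' hVV
        (n := L * m) (fun s => (norm_driveB_sub_le k₂ s (h1 (hU s)) (h1 (hU' s)) (h1 (hV s))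
          (h1 (hV' s)) (hUU s) (hVV s) hd).trans ?_) s).trans (by linarith)
      have : 9 * (1 + |k₂|) * (m + K * m) ≤ 9 * (2 + |k₁| + |k₂|) * (m + K * m) :=
        mul_le_mul_of_nonneg_right (by linarith) hKm
      refine this.trans (le_of_eq ?_)
      rw [hL]; ring
  refine ⟨ρ, hρ, M, by positivity, ε₁, by positivity, fun ε hε hεε => ⟨?_, ?_⟩⟩
  · -- Banach's fixed point theorem in the ball of radius `ρ`.
    have hex : ∀ w : C(AddCircle (2 * Real.pi), ℂ) × C(AddCircle (2 * Real.pi), ℂ),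
        ∃ w' : C(AddCircle (2 * Real.pi), ℂ) × C(AddCircle (2 * Real.pi), ℂ),
        IsPeriodicResponse (logForcing ε (fun s => w.1 s) fun s =>
          driveA k₁ (C (fun s => w.1 s) fun s => w.2 s) (D (fun s => w.1 s) fun s => w.2 s) s
            (w.1 s) (w.2 s)) (fun s => w'.1 s) ∧
        IsPeriodicResponse (logForcing ε (fun s => w.2 s) fun s =>
          driveB k₂ (D (fun s => w.1 s) fun s => w.2 s) s (w.1 s) (w.2 s)) (fun s => w'.2 s) := by
      intro w
      have c1 := continuous_circle_coe w.1
      have c2 := continuous_circle_coe w.2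
      have p1 := periodic_circle_coe w.1
      have p2 := periodic_circle_coe w.2
      obtain ⟨E, hE⟩ := exists_isPeriodicResponse
        (continuous_logForcing ε c1 (continuous_driveA k₁ (C (fun s => w.1 s) fun s => w.2 s)
          (D (fun s => w.1 s) fun s => w.2 s) c1 c2))
        (logForcing_periodic p1 fun s => by
          have h1 := p1 s
          have h2 := p2 s
          simp only [driveA_add_two_pi] at h1 h2 ⊢
          rw [h1, h2])
      obtain ⟨F, hF⟩ := exists_isPeriodicResponse
        (continuous_logForcing ε c2 (continuous_driveB k₂
          (D (fun s => w.1 s) fun s => w.2 s) c1 c2))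
        (logForcing_periodic p2 fun s => by
          have h1 := p1 s
          have h2 := p2 s
          simp only [driveB_add_two_pi] at h1 h2 ⊢
          rw [h1, h2])
      exact ⟨(circleLift E hE.continuous hE.periodic, circleLift F hF.continuous hF.periodic),
        hE, hF⟩
    choose T hTA hTB using hex
    have hb : ∀ w : C(AddCircle (2 * Real.pi), ℂ) × C(AddCircle (2 * Real.pi), ℂ), ‖w‖ ≤ ρ →
        (∀ s : ℝ, ‖w.1 s‖ ≤ ρ) ∧ ∀ s : ℝ, ‖w.2 s‖ ≤ ρ := fun w hw =>
      ⟨fun s => (w.1.norm_coe_le_norm _).trans ((norm_fst_le w).trans hw),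
        fun s => (w.2.norm_coe_le_norm _).trans ((norm_snd_le w).trans hw)⟩
    have hlip : ∀ w w', ‖w‖ ≤ ρ → ‖w'‖ ≤ ρ → ‖T w - T w'‖ ≤ ‖w - w'‖ / 2 := by
      intro w w' hw hw'
      obtain ⟨hE, hF⟩ := step ε hε hεε _ _ _ _ _ _ _ _ ‖w - w'‖ (continuous_circle_coe w.1)
        (continuous_circle_coe w.2) (continuous_circle_coe w'.1) (continuous_circle_coe w'.2)
        (hb w hw).1 (hb w hw).2 (hb w' hw').1 (hb w' hw').2
        (fun s => ((w.1 - w'.1).norm_coe_le_norm s).trans (norm_fst_le (w - w')))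
        (fun s => ((w.2 - w'.2).norm_coe_le_norm s).trans (norm_snd_le (w - w')))
        (hTA w) (hTB w) (hTA w') (hTB w')
      exact norm_prod_le_iff.mpr ⟨norm_circle_le (by positivity) hE,
        norm_circle_le (by positivity) hF⟩
    have hT0 : ‖T 0‖ ≤ 102 * ε := by
      have hA := norm_le_of_isPeriodicResponse_logForcing_zero (n := 6) hε.le
        (continuous_driveA _ _ _ continuous_zero continuous_zero) (hTA 0)
        (fun s => norm_driveA_le _ _ _ _ _ (by simp))
      have hB := norm_le_of_isPeriodicResponse_logForcing_zero (n := 6) hε.le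
        (continuous_driveB _ _ continuous_zero continuous_zero) (hTB 0)
        (fun s => norm_driveB_le _ _ _ _ (by simp))
      exact norm_prod_le_iff.mpr ⟨norm_circle_le (by positivity) fun s => (hA s).trans (by linarith),
        norm_circle_le (by positivity) fun s => (hB s).trans (by linarith)⟩
    have hTw : ∀ w, ‖w‖ ≤ ρ → ‖T w‖ ≤ ‖w‖ / 2 + 102 * ε := fun w hw => by
      have h1 := hlip w 0 hw (by simpa using hρ.le)
      rw [sub_zero] at h1
      have h2 := norm_le_norm_sub_add (T w) (T 0)
      linarith
    have hερ : 204 * ε ≤ ρ := by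
      have := hεε.trans (min_le_right _ _)
      linarith
    have hmaps : Set.MapsTo T (Metric.closedBall 0 ρ) (Metric.closedBall 0 ρ) := fun w hw => by
      rw [mem_closedBall_zero_iff] at hw ⊢
      linarith [hTw w hw]
    have hcontr : ContractingWith (1 / 2 : NNReal) (hmaps.restrict T _ _) := by
      refine ⟨by rw [← NNReal.coe_lt_coe]; norm_num, LipschitzWith.of_dist_le_mul ?_⟩
      rintro ⟨w, hw⟩ ⟨w', hw'⟩
      rw [mem_closedBall_zero_iff] at hw hw'
      have := hlip w w' hw hw'
      simp only [Subtype.dist_eq, Set.MapsTo.val_restrict_apply, dist_eq_norm]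
      push_cast
      linarith
    obtain ⟨w, hw, hfix, -⟩ := hcontr.exists_fixedPoint' Metric.isClosed_closedBall.isComplete
      hmaps (x := 0) (by simpa using hρ.le) (edist_ne_top _ _)
    rw [mem_closedBall_zero_iff] at hw
    have hwε : ‖w‖ ≤ 204 * ε := by
      have := hTw w hw
      rw [hfix] at this
      linarith
    have c1 := continuous_circle_coe w.1
    have c2 := continuous_circle_coe w.2
    have hA := hTA w
    have hB := hTB w
    rw [hfix] at hA hB
    obtain ⟨m1, m2, m3, -⟩ := H _ _ c1 c2 (hb w hw).1 (hb w hw).2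
    obtain ⟨a1, a2, -⟩ := (isPeriodicResponse_logForcing_iff m1).mp hA
    obtain ⟨b1, b2, -⟩ := (isPeriodicResponse_logForcing_iff m2).mp hB
    have n1 : ∀ s : ℝ, ‖w.1 s‖ ≤ 204 * ε := fun s =>
      (w.1.norm_coe_le_norm _).trans ((norm_fst_le w).trans hwε)
    have n2 : ∀ s : ℝ, ‖w.2 s‖ ≤ 204 * ε := fun s =>
      (w.2.norm_coe_le_norm _).trans ((norm_snd_le w).trans hwε)
    obtain ⟨hc, hd⟩ := m3 0 0 (204 * ε) continuous_zero continuous_zero (by simpa using hρ.le)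
      (by simpa using hρ.le) (by simpa using n1) (by simpa using n2)
    rw [hC0] at hc
    rw [hD0] at hd
    have e1 : 204 * ε ≤ M * ε := by rw [hM]; nlinarith [mul_nonneg hK hε.le]
    have e2 : K * (204 * ε) ≤ M * ε := by rw [hM]; nlinarith [mul_nonneg hK hε.le]
    exact ⟨_, _, _, _, ⟨a1, b1, a2, b2⟩, fun s => (n1 s).trans e1, fun s => (n2 s).trans e1,
      hc.trans e2, hd.trans e2⟩
  · intro U V c d U' V' c' d' h h' mU mV mU' mV' hU hV hU' hV' hc hd hc' hd'
    have resp : ∀ {U V c d}, IsPhaseSolution k₁ k₂ ε c d U V →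
        periodMean (fun s => (U s).im) = 0 → periodMean (fun s => (V s).im) = 0 →
        (∀ s, ‖U s‖ ≤ ρ) → (∀ s, ‖V s‖ ≤ ρ) →
        |c - τ * Real.arccos (-(k₁ * Real.cos d₀))| ≤ ρ → |d - d₀| ≤ ρ →
        c = C U V ∧ d = D U V ∧ IsPeriodicResponse
          (logForcing ε U fun s => driveA k₁ (C U V) (D U V) s (U s) (V s)) U ∧
        IsPeriodicResponse (logForcing ε V fun s => driveB k₂ (D U V) s (U s) (V s)) V := by
      intro U V c d h mU mV hU hV hc hd
      have mA := h.periodMean_im_driveA hε.ne'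
      have mB := h.periodMean_im_driveB hε.ne'
      obtain ⟨rfl, rfl⟩ := (H U V h.continuous_fst h.continuous_snd hU hV).2.2.2 c d hc hd mA mB
      exact ⟨rfl, rfl, (isPeriodicResponse_logForcing_iff mA).mpr
          ⟨h.hasDerivAt_fst, h.periodic_fst, mU⟩,
        (isPeriodicResponse_logForcing_iff mB).mpr ⟨h.hasDerivAt_snd, h.periodic_snd, mV⟩⟩
    obtain ⟨ec, ed, rU, rV⟩ := resp h mU mV hU hV hc hd
    obtain ⟨ec', ed', rU', rV'⟩ := resp h' mU' mV' hU' hV' hc' hd'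
    have hsub : ∀ {W W' : ℝ → ℂ}, (∀ s, ‖W s‖ ≤ ρ) → (∀ s, ‖W' s‖ ≤ ρ) →
        ∀ s, ‖W s - W' s‖ ≤ ρ + ρ := fun h h' s => (norm_sub_le _ _).trans (add_le_add (h s) (h' s))
    obtain ⟨rfl, rfl⟩ := eq_of_forall_norm_sub_le_half (hsub hU hU') (hsub hV hV')
      fun m hm hm' => step ε hε hεε U V U' V' U V U' V' m h.continuous_fst h.continuous_snd
        h'.continuous_fst h'.continuous_snd hU hV hU' hV' hm hm' rU rV rU' rV'
    exact ⟨rfl, rfl, ec.trans ec'.symm, ed.trans ed'.symm⟩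

/-! ### Branches of periodic solutions -/

theorem periodMean_comp_sub {f : ℝ → ℝ} (hp : Function.Periodic f (2 * Real.pi)) (a : ℝ) :
    periodMean (fun s => f (s - a)) = periodMean f := by
  have h := hp.intervalIntegral_add_eq (0 - a) 0
  rw [zero_add, show 0 - a + 2 * Real.pi = 2 * Real.pi - a by ring] at h
  rw [periodMean, intervalIntegral.integral_comp_sub_right, h, periodMean]

/-- A shift of time and of the phases normalizes the phase parts of `U` and `V` to have mean
zero. -/
theorem IsPhaseSolution.exists_normalized {k₁ k₂ ε c d m : ℝ} {U V : ℝ → ℂ}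
    (h : IsPhaseSolution k₁ k₂ ε c d U V) (hU : ∀ s, ‖U s‖ ≤ m) (hV : ∀ s, ‖V s‖ ≤ m) :
    ∃ U' V' c' d', IsPhaseSolution k₁ k₂ ε c' d' U' V' ∧
      phaseTrajectory c' d' U' V' = phaseTrajectory c d U V ∧
      periodMean (fun s => (U' s).im) = 0 ∧ periodMean (fun s => (V' s).im) = 0 ∧
      (∀ s, ‖U' s‖ ≤ 2 * m) ∧ (∀ s, ‖V' s‖ ≤ 2 * m) ∧ |c' - c| ≤ 2 * m ∧ |d' - d| ≤ 2 * m := by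
  set a := periodMean fun s => (U s).im with ha
  set b := periodMean fun s => (V s).im with hb
  have ham : |a| ≤ m := abs_periodMean_le fun s => (Complex.abs_im_le_norm _).trans (hU s)
  have hbm : |b| ≤ m := abs_periodMean_le fun s => (Complex.abs_im_le_norm _).trans (hV s)
  have cU := h.continuous_fst
  have cV := h.continuous_snd
  have hm := (abs_nonneg _).trans ham
  have eA : ∀ s, driveA k₁ (c + a) (d + (b - a)) s (U (s - a) - a * Complex.I)
      (V (s - a) - b * Complex.I) = driveA k₁ c d (s - a) (U (s - a)) (V (s - a)) := fun s => by
    rw [driveA, driveA]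
    congr 1
    · congr 1; push_cast; ring
    · rw [show s - (c + a) = s - a - c by ring,
        show V (s - a) - b * Complex.I + ((s + (d + (b - a)) : ℝ) : ℂ) * Complex.I
          = V (s - a) + ((s - a + d : ℝ) : ℂ) * Complex.I by push_cast; ring]
  have eB : ∀ s, driveB k₂ (d + (b - a)) s (U (s - a) - a * Complex.I)
      (V (s - a) - b * Complex.I) = driveB k₂ d (s - a) (U (s - a)) (V (s - a)) := fun s => by
    rw [driveB, driveB]
    congr 1
    · congr 1; push_cast; ring
    · rw [show U (s - a) - a * Complex.I + (s : ℂ) * Complex.I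
          = U (s - a) + ((s - a : ℝ) : ℂ) * Complex.I by push_cast; ring]
  have hre : ∀ (z : ℂ) (r : ℝ), (z - r * Complex.I).re = z.re := fun z r => by simp
  have him : ∀ (z : ℂ) (r : ℝ), (z - r * Complex.I).im = z.im - r := fun z r => by simp
  have hn : ∀ {z : ℂ} {r : ℝ}, ‖z‖ ≤ m → |r| ≤ m → ‖z - r * Complex.I‖ ≤ 2 * m := fun {z r} hz hr => by
    refine (norm_sub_le _ _).trans ?_
    rw [norm_mul, Complex.norm_I, mul_one, Complex.norm_real, Real.norm_eq_abs]
    linarith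
  refine ⟨fun s => U (s - a) - a * Complex.I, fun s => V (s - a) - b * Complex.I, c + a,
    d + (b - a), ⟨fun s => ?_, fun s => ?_, fun s => ?_, fun s => ?_⟩, ?_, ?_, ?_,
    fun s => hn (hU _) ham, fun s => hn (hV _) hbm, ?_, ?_⟩
  · rw [hre, eA]
    exact ((h.hasDerivAt_fst (s - a)).comp_sub_const s a).sub_const _
  · rw [hre, eB]
    exact ((h.hasDerivAt_snd (s - a)).comp_sub_const s a).sub_const _
  · simp only [show s + 2 * Real.pi - a = s - a + 2 * Real.pi by ring, h.periodic_fst (s - a)]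
  · simp only [show s + 2 * Real.pi - a = s - a + 2 * Real.pi by ring, h.periodic_snd (s - a)]
  · funext t
    have h1 : U (t + (c + a) - a) - a * Complex.I + ((t + (c + a) : ℝ) : ℂ) * Complex.I
        = U (t + c) + ((t + c : ℝ) : ℂ) * Complex.I := by
      rw [show t + (c + a) - a = t + c by ring]; push_cast; ring
    have h2 : V (t + (c + a) - a) - b * Complex.I
        + ((t + (c + a) + (d + (b - a)) : ℝ) : ℂ) * Complex.I
        = V (t + c) + ((t + c + d : ℝ) : ℂ) * Complex.I := by
      rw [show t + (c + a) - a = t + c by ring]; push_cast; ring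
    rw [phaseTrajectory, h1, h2, phaseTrajectory]
  · simp only [him]
    rw [periodMean_sub (by fun_prop) continuous_const, periodMean_const,
      periodMean_comp_sub (f := fun s => (U s).im) (fun s => by simp only [h.periodic_fst s]),
      ← ha, sub_self]
  · simp only [him]
    rw [periodMean_sub (by fun_prop) continuous_const, periodMean_const,
      periodMean_comp_sub (f := fun s => (V s).im) (fun s => by simp only [h.periodic_snd s]),
      ← hb, sub_self]
  · rw [add_sub_cancel_left]; linarith
  · rw [add_sub_cancel_left]
    exact (abs_sub b a).trans (by linarith)

theorem dist_phaseTrajectory_zero_le {c c₀ d d₀ m : ℝ} {U V : ℝ → ℂ} (hm : m ≤ 1)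
    (hU : ∀ s, ‖U s‖ ≤ m) (hV : ∀ s, ‖V s‖ ≤ m) (hc : |c - c₀| ≤ m) (hd : |d - d₀| ≤ m) :
    dist (phaseTrajectory c d U V 0) (torusPoint c₀ (c₀ + d₀)) ≤ 9 * m := by
  have hm0 := (abs_nonneg _).trans hc
  have hU0 : ‖U (0 + c) - 0‖ ≤ m := by simpa using hU (0 + c)
  have hV0 : ‖V (0 + c) - 0‖ ≤ m := by simpa using hV (0 + c)
  have h1 := norm_exp_add_mul_I_sub_le (z := U (0 + c)) (z' := 0) (0 + c) c₀
    ((hU _).trans hm) (by simp)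
  have h2 := norm_exp_add_mul_I_sub_le (z := V (0 + c)) (z' := 0) (0 + c + d) (c₀ + d₀)
    ((hV _).trans hm) (by simp)
  rw [show 0 + c - c₀ = c - c₀ by ring, zero_add (((c₀ : ℝ) : ℂ) * Complex.I)] at h1
  rw [show 0 + c + d - (c₀ + d₀) = (c - c₀) + (d - d₀) by ring,
    zero_add (((c₀ + d₀ : ℝ) : ℂ) * Complex.I)] at h2
  replace h1 := h1.trans (show _ ≤ 9 * m by linarith)
  replace h2 := h2.trans (show _ ≤ 9 * m by linarith [abs_add_le (c - c₀) (d - d₀)])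
  refine (dist_pi_le_iff (by positivity)).mpr fun i => ?_
  rw [Real.dist_eq]
  fin_cases i
  · refine le_trans (le_of_eq ?_) ((Complex.abs_im_le_norm _).trans h1)
    rw [Complex.sub_im, Complex.exp_ofReal_mul_I_im]; rfl
  · refine le_trans (le_of_eq ?_) ((Complex.abs_re_le_norm _).trans h1)
    rw [Complex.sub_re, Complex.exp_ofReal_mul_I_re]; rfl
  · refine le_trans (le_of_eq ?_) ((Complex.abs_im_le_norm _).trans h2)
    rw [Complex.sub_im, Complex.exp_ofReal_mul_I_im]; rfl
  · refine le_trans (le_of_eq ?_) ((Complex.abs_re_le_norm _).trans h2)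
    rw [Complex.sub_re, Complex.exp_ofReal_mul_I_re]; rfl

/-- The branch of periodic solutions issuing from a nondegenerate zero of the bifurcation
function, with its local uniqueness. -/
theorem exists_branch_isPeriodicSolution {k₁ k₂ d₀ τ : ℝ} (hk₁ : |k₁| < 1) (hk₂ : k₂ ≠ 0)
    (hd₀ : Real.sin d₀ = 0) (hτ : τ = 1 ∨ τ = -1) {p : Fin 4 → ℝ}
    (hp : p = torusPoint (τ * Real.arccos (-(k₁ * Real.cos d₀)))
      (τ * Real.arccos (-(k₁ * Real.cos d₀)) + d₀)) :
    ∃ ε₁ > 0, ∃ δ > 0, ∃ x : ℝ → ℝ → Fin 4 → ℝ,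
      (∀ ε, 0 < ε → ε ≤ ε₁ → IsPeriodicSolution k₁ k₂ ε (x ε)) ∧
      Tendsto (fun ε => x ε 0) (𝓝[>] 0) (𝓝 p) ∧
      ∀ ε, 0 < ε → ε ≤ ε₁ → ∀ y y', IsPeriodicSolution k₁ k₂ ε y → IsPeriodicSolution k₁ k₂ ε y' →
        y 0 ∈ Metric.ball p δ → y' 0 ∈ Metric.ball p δ → y = y' := by
  obtain ⟨ρ, hρ, M, hM, ε₁, hε₁, H⟩ := exists_unique_normalized_isPhaseSolution hk₁ hk₂ hd₀ hτ
  set c₀ := τ * Real.arccos (-(k₁ * Real.cos d₀)) with hc₀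
  set E := Real.exp (12 * Real.pi) with hE
  have hE0 : 0 < E := Real.exp_pos _
  have hE1 : 1 ≤ E := Real.one_le_exp (by positivity)
  set δ := min ρ 1 / (12 * E) with hδ
  have hδ0 : 0 < δ := by positivity
  have hEδ : 12 * (E * δ) = min ρ 1 := by rw [hδ]; field_simp
  have hδ1 : δ ≤ 1 := by
    have := min_le_right ρ 1
    nlinarith
  choose U V c d hsol hU hV hc hd using fun (ε : ℝ) (h : 0 < ε ∧ ε ≤ ε₁) => (H ε h.1 h.2).1
  classical
  set x : ℝ → ℝ → Fin 4 → ℝ := fun ε => if h : 0 < ε ∧ ε ≤ ε₁ then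
    phaseTrajectory (c ε h) (d ε h) (U ε h) (V ε h) else 0
  have hx : ∀ ε (h : 0 < ε ∧ ε ≤ ε₁),
      x ε = phaseTrajectory (c ε h) (d ε h) (U ε h) (V ε h) := fun ε h => dif_pos h
  refine ⟨min ε₁ δ, by positivity, δ, hδ0, x, fun ε hε hεε => ?_, ?_, ?_⟩
  · rw [hx ε ⟨hε, hεε.trans (min_le_left _ _)⟩]
    exact (hsol ε _).isPeriodicSolution
  · rw [tendsto_iff_dist_tendsto_zero]
    have hlim : Tendsto (fun ε : ℝ => 9 * (M * ε)) (𝓝[>] 0) (𝓝 0) := by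
      have : Tendsto (fun ε : ℝ => 9 * (M * ε)) (𝓝 0) (𝓝 (9 * (M * 0))) :=
        (by fun_prop : Continuous fun ε : ℝ => 9 * (M * ε)).tendsto 0
      rw [mul_zero, mul_zero] at this
      exact this.mono_left nhdsWithin_le_nhds
    refine squeeze_zero' (Eventually.of_forall fun _ => dist_nonneg) ?_ hlim
    have hs : ∀ᶠ ε in 𝓝[>] (0 : ℝ), ε < min ε₁ (1 / M) :=
      (gt_mem_nhds (by positivity)).filter_mono nhdsWithin_le_nhds
    filter_upwards [hs, self_mem_nhdsWithin] with ε h1 h2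
    have h : 0 < ε ∧ ε ≤ ε₁ := ⟨h2, h1.le.trans (min_le_left _ _)⟩
    have hMε : M * ε ≤ 1 := by
      have := h1.le.trans (min_le_right _ _)
      rwa [le_div_iff₀ hM, mul_comm] at this
    rw [hx ε h, hp]
    exact dist_phaseTrajectory_zero_le hMε (hU ε h) (hV ε h) (hc ε h) (hd ε h)
  · intro ε hε hεε y y' hy hy' hyδ hyδ'
    have hεδ := hεε.trans (min_le_right _ _)
    have hm : E * (2 * δ + ε) ≤ min ρ 1 / 4 := by nlinarith
    have hm1 : E * (2 * δ + ε) ≤ 1 / 2 := by linarith [min_le_right ρ 1]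
    have hm2 : 2 * (2 * (E * (2 * δ + ε))) ≤ ρ := by linarith [min_le_left ρ 1]
    have key : ∀ y, IsPeriodicSolution k₁ k₂ ε y → y 0 ∈ Metric.ball p δ →
        ∃ U V c d, IsPhaseSolution k₁ k₂ ε c d U V ∧ y = phaseTrajectory c d U V ∧
          periodMean (fun s => (U s).im) = 0 ∧ periodMean (fun s => (V s).im) = 0 ∧
          (∀ s, ‖U s‖ ≤ ρ) ∧ (∀ s, ‖V s‖ ≤ ρ) ∧ |c - c₀| ≤ ρ ∧ |d - d₀| ≤ ρ := by
      intro y hy hyδ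
      rw [hp, Metric.mem_ball] at hyδ
      obtain ⟨U, V, h1, h2, h3, h4⟩ :=
        hy.exists_isPhaseSolution hε.le (hεδ.trans hδ1) hyδ.le hm1
      rw [add_sub_cancel_left] at h1 h4
      obtain ⟨U', V', c', d', g1, g2, g3, g4, g5, g6, g7, g8⟩ := h1.exists_normalized h2 h3
      exact ⟨U', V', c', d', g1, h4.trans g2.symm, g3, g4, fun s => (g5 s).trans hm2,
        fun s => (g6 s).trans hm2, g7.trans hm2, g8.trans hm2⟩
    obtain ⟨U, V, c, d, a1, rfl, a3, a4, a5, a6, a7, a8⟩ := key y hy hyδ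
    obtain ⟨U', V', c', d', b1, rfl, b3, b4, b5, b6, b7, b8⟩ := key y' hy' hyδ'
    obtain ⟨rfl, rfl, rfl, rfl⟩ := (H ε hε (hεε.trans (min_le_left _ _))).2 U V c d U' V' c' d'
      a1 b1 a3 a4 b3 b4 a5 a6 b5 b6 a7 a8 b7 b8
    rfl

theorem torusPoint_add {θ d : ℝ} (hd : Real.sin d = 0) : torusPoint θ (θ + d) =
    ![Real.sin θ, Real.cos θ, Real.cos d * Real.sin θ, Real.cos d * Real.cos θ] := by
  rw [torusPoint, Real.sin_add, Real.cos_add, hd, mul_zero, add_zero, mul_zero, sub_zero,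
    mul_comm (Real.sin θ), mul_comm (Real.cos θ)]

theorem torusPoint_arccos {k d τ : ℝ} (hk : |k| < 1) (hτ : τ = 1 ∨ τ = -1) (hd : Real.sin d = 0) :
    torusPoint (τ * Real.arccos (-(k * Real.cos d))) (τ * Real.arccos (-(k * Real.cos d)) + d) =
      ![τ * √(1 - k ^ 2), -(k * Real.cos d), Real.cos d * (τ * √(1 - k ^ 2)), -k] := by
  have hd2 : Real.cos d ^ 2 = 1 := by
    have := Real.sin_sq_add_cos_sq d
    rw [hd] at this; linarith
  obtain ⟨h1, h2⟩ := abs_lt.mp (show |-(k * Real.cos d)| < 1 by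
    rw [abs_neg, abs_mul]
    exact (mul_le_of_le_one_right (abs_nonneg _) (Real.abs_cos_le_one _)).trans_lt hk)
  have hs : Real.sin (τ * Real.arccos (-(k * Real.cos d))) = τ * √(1 - k ^ 2) := by
    have : Real.sin (Real.arccos (-(k * Real.cos d))) = √(1 - k ^ 2) := by
      rw [Real.sin_arccos, neg_sq, mul_pow, hd2, mul_one]
    rcases hτ with rfl | rfl
    · rw [one_mul, one_mul, this]
    · rw [neg_one_mul, Real.sin_neg, this, neg_one_mul]
  have hc : Real.cos (τ * Real.arccos (-(k * Real.cos d))) = -(k * Real.cos d) := by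
    rcases hτ with rfl | rfl
    · rw [one_mul, Real.cos_arccos h1.le h2.le]
    · rw [neg_one_mul, Real.cos_neg, Real.cos_arccos h1.le h2.le]
  rw [torusPoint_add hd, hs, hc, show Real.cos d * -(k * Real.cos d) = -k by
    linear_combination -k * hd2]

theorem proposition1 (k₁ k₂ : ℝ) (hk₂ : k₂ ≠ 0) :
    (1 < |k₁| → ∀ θ η : ℝ, ¬ IsLimitOfPeriodicSolutions k₁ k₂ (torusPoint θ η)) ∧
    (|k₁| < 1 →
      ∃ p : Fin 4 → (Fin 4 → ℝ),
        Function.Injective p ∧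
        {q : Fin 4 → ℝ | (∃ θ η : ℝ, q = torusPoint θ η) ∧ IsLimitOfPeriodicSolutions k₁ k₂ q}
          = Set.range p ∧
        ∃ ε₀ : ℝ, 0 < ε₀ ∧ ∃ x : Fin 4 → ℝ → (ℝ → Fin 4 → ℝ),
          (∀ ε ∈ Set.Ioc 0 ε₀,
            (∀ i, IsPeriodicSolution k₁ k₂ ε (x i ε)) ∧ Function.Injective (fun i => x i ε)) ∧
          (∀ i, Tendsto (fun ε => x i ε 0) (𝓝[>] 0) (𝓝 (p i))) ∧
          (|k₁ * k₂| ≠ 1 →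
            ∃ δ : ℝ, 0 < δ ∧ ∀ ε ∈ Set.Ioc 0 ε₀, ∀ i,
              x i ε 0 ∈ Metric.ball (p i) δ ∧
              ∀ y : ℝ → Fin 4 → ℝ, IsPeriodicSolution k₁ k₂ ε y →
                y 0 ∈ Metric.ball (p i) δ → y = x i ε)) := by
  refine ⟨fun h θ η => not_isLimitOfPeriodicSolutions hk₂ h θ η, fun hk₁ => ?_⟩
  set S := √(1 - k₁ ^ 2) with hS
  have hk₁2 : k₁ ^ 2 < 1 := (sq_lt_one_iff_abs_lt_one k₁).mpr hk₁
  have hS0 : 0 < S := Real.sqrt_pos.mpr (by linarith)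
  -- The four zeros: `η - θ ∈ {0, π}`, and then `θ = ± arccos (-k₁ cos (η - θ))`.
  set d₀ : Fin 4 → ℝ := ![0, 0, Real.pi, Real.pi] with hd₀
  set τ : Fin 4 → ℝ := ![1, -1, 1, -1] with hτ
  have hsin : ∀ i, Real.sin (d₀ i) = 0 := fun i => by fin_cases i <;> simp [hd₀]
  have hτ1 : ∀ i, τ i = 1 ∨ τ i = -1 := fun i => by fin_cases i <;> simp [hτ]
  set p : Fin 4 → Fin 4 → ℝ := fun i => torusPoint
    (τ i * Real.arccos (-(k₁ * Real.cos (d₀ i))))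
    (τ i * Real.arccos (-(k₁ * Real.cos (d₀ i))) + d₀ i) with hp
  have hpv : ∀ i, p i =
      ![τ i * S, -(k₁ * Real.cos (d₀ i)), Real.cos (d₀ i) * (τ i * S), -k₁] := fun i =>
    torusPoint_arccos hk₁ (hτ1 i) (hsin i)
  have hinj : Function.Injective p := by
    intro i j hij
    rw [hpv, hpv] at hij
    -- The first coordinate determines `τ`, and then the third one `cos d₀`.
    have h0 := congrFun hij 0
    have h2 := congrFun hij 2
    fin_cases i <;> fin_cases j <;> simp [hτ, hd₀] at h0 h2 ⊢ <;> linarith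
  choose ε₁ hε₁ δ hδ x hx hlim huniq using fun i =>
    exists_branch_isPeriodicSolution (k₂ := k₂) hk₁ hk₂ (hsin i) (hτ1 i) (p := p i) rfl
  have hsub : ∀ᶠ ε in 𝓝[>] (0 : ℝ), ∀ i, ε < ε₁ i :=
    eventually_all.mpr fun i => (gt_mem_nhds (hε₁ i)).filter_mono nhdsWithin_le_nhds
  obtain ⟨δ₀, hδ₀, hδ₀pos⟩ := ((eventually_all.mpr fun i =>
    (gt_mem_nhds (hδ i)).filter_mono nhdsWithin_le_nhds : ∀ᶠ r in 𝓝[>] (0 : ℝ), ∀ i, r < δ i).and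
      self_mem_nhdsWithin).exists
  have hball : ∀ᶠ ε in 𝓝[>] (0 : ℝ), ∀ i, x i ε 0 ∈ Metric.ball (p i) δ₀ :=
    eventually_all.mpr fun i => (hlim i).eventually (Metric.ball_mem_nhds _ hδ₀pos)
  have hne : ∀ᶠ ε in 𝓝[>] (0 : ℝ), ∀ i j, i ≠ j → x i ε 0 ≠ x j ε 0 :=
    eventually_all.mpr fun i => eventually_all.mpr fun j => by
      by_cases hij : i = j
      · exact Eventually.of_forall fun _ h => absurd hij h
      · exact ((hlim i).prodMk_nhds (hlim j)).eventually
          (isClosed_diagonal.isOpen_compl.mem_nhds (hinj.ne hij)) |>.mono fun _ h _ => h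
  obtain ⟨ε₀, hε₀, hε₀sub⟩ := mem_nhdsGT_iff_exists_Ioc_subset.mp ((hsub.and hball).and hne)
  refine ⟨p, hinj, ?_, ε₀, hε₀, x, fun ε hε => ?_, hlim, fun _ => ⟨δ₀, hδ₀pos, fun ε hε i => ?_⟩⟩
  · ext q
    constructor
    · rintro ⟨⟨θ, η, rfl⟩, h⟩
      have hs := h.sin_eq_zero hk₂
      have hc := h.cos_eq hk₂
      rw [saturationGain_of_abs_le hk₁.le] at hc
      have hcσ : Real.cos (η - θ) = 1 ∨ Real.cos (η - θ) = -1 := by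
        rw [← sq_eq_one_iff]
        have := Real.sin_sq_add_cos_sq (η - θ)
        rw [hs] at this; linarith
      have hsS : Real.sin θ = S ∨ Real.sin θ = -S := by
        rw [← sq_eq_sq_iff_eq_or_eq_neg, hS, Real.sq_sqrt (by linarith)]
        have h1 := Real.sin_sq_add_cos_sq θ
        have h2 := Real.sin_sq_add_cos_sq (η - θ)
        rw [hs] at h2
        rw [hc] at h1
        linear_combination h1 - k₁ ^ 2 * h2
      have hq := torusPoint_add (θ := θ) hs
      rw [add_sub_cancel] at hq
      rw [hq, hc]
      rcases hcσ with h1 | h1 <;> rcases hsS with h2 | h2 <;> rw [h1, h2]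
      · refine ⟨0, ?_⟩
        rw [hpv]; ext i; fin_cases i <;> simp [hτ, hd₀] <;> ring
      · refine ⟨1, ?_⟩
        rw [hpv]; ext i; fin_cases i <;> simp [hτ, hd₀] <;> ring
      · refine ⟨2, ?_⟩
        rw [hpv]; ext i; fin_cases i <;> simp [hτ, hd₀] <;> ring
      · refine ⟨3, ?_⟩
        rw [hpv]; ext i; fin_cases i <;> simp [hτ, hd₀] <;> ring
    · rintro ⟨i, rfl⟩
      refine ⟨⟨_, _, rfl⟩, ?_⟩
      have hseq : Tendsto (fun m : ℕ => ε₁ i / ((m : ℝ) + 1)) atTop (𝓝 0) := by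
        simpa [div_eq_mul_inv] using tendsto_one_div_add_atTop_nhds_zero_nat.const_mul (ε₁ i)
      have hpos : ∀ m : ℕ, 0 < ε₁ i / ((m : ℝ) + 1) := fun m => div_pos (hε₁ i) (by positivity)
      refine ⟨fun m => ε₁ i / ((m : ℝ) + 1), fun m => x i (ε₁ i / ((m : ℝ) + 1)), hpos, hseq,
        fun m => hx i _ (hpos m) (div_le_self (hε₁ i).le (by linarith [m.cast_nonneg (α := ℝ)])),
        (hlim i).comp (tendsto_nhdsWithin_iff.mpr ⟨hseq, Eventually.of_forall hpos⟩)⟩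
  · obtain ⟨⟨h1, -⟩, h3⟩ := hε₀sub hε
    exact ⟨fun i => hx i ε hε.1 (h1 i).le, fun i j hij => by
      by_contra hne
      exact h3 i j hne (congrFun hij 0)⟩
  · obtain ⟨⟨h1, h2⟩, -⟩ := hε₀sub hε
    have hmono := Metric.ball_subset_ball (x := p i) (hδ₀ i).le
    exact ⟨h2 i, fun y hy hyb => huniq i ε hε.1 (h1 i).le y _ hy (hx i ε hε.1 (h1 i).le)
      (hmono hyb) (hmono (h2 i))⟩
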